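/- Let $t$ and $q$ be formal parameters. Consider the semi-infinite matrices with rows and columns indexed by $i,j\in\{0,1,2,\dots\}$: the identity $I$; $A$ with $A_{ii}=t^i$ and zeros elsewhere; $\epsilon$ with $\epsilon_{i,i+1}=1$ and zeros elsewhere; $\delta$ with $\delta_{i,i-1}=1-t^{i}$ and zeros elsewhere; and $D(u)$ with $D(u)_{ii}=u^i$ and zeros elsewhere. For $L\ge 2$, $0\le J\le L$ and $0\le M<L$ let $a^{(L)}_{JM}$ be the following tensor products of $L-1$ such matrices (Prolhac–Evans–Mallick): $$a^{(L)}_{JM}=\begin{cases} 0 & 0<M<J,\\ A^{\otimes(J-1)}\otimes\delta\otimes I^{\otimes(M-J-1)}\otimes\epsilon\otimes I^{\otimes(L-M-1)} & 0<J<M<L,\\ I^{\otimes(M-1)}\otimes\epsilon\otimes I^{\otimes(L-M-1)} & J=0<M<L,\\ A^{\otimes(J-1)}\otimes I^{\otimes(L-J)} & 0<J=M<L,\\ I^{\otimes(L-1)} & J=M=0,\\ A^{\otimes(J-1)}\otimes\delta\otimes I^{\otimes(L-J-1)} & 0<J<L,\ M=0,\\ A^{\otimes(L-1)} & J=L,\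 M=0, \end{cases}$$ and put $a^{(L)}_{JM}(x)=x\,a^{(L)}_{JM}$ if $J>0$ and $a^{(L)}_{0M}(x)=a^{(L)}_{0M}$. Here class $1$ is the strongest; to pass to the order in which class $L$ is the strongest, put $0^*=0$ and $J^*=L+1-J$ for $1\le J\le L$ (so $^*$ depends on $L$). Define $X^{(1)}_0(x)=1$, $X^{(1)}_1(x)=x$ and, for $L\ge2$ and $0\le J\le L$, $$X^{(L)}_J(x)=\sum_{M\in\{0,2,3,\dots,L\}}a^{(L)}_{J^*M^*}(x)\otimes X^{(L-1)}_{\max(0,M-1)}(x).$$ Let $S^{(L)}=s^{(L)}\otimes\cdots\otimes s^{(1)}$, where $s^{(1)}=1$ and $s^{(L)}=D(q^{L-1})\otimes\cdots\otimes D(q^2)\otimes D(q)$ for $L\ge2$. For $n\ge1$, $L\ge1$ and a composition $\mu=(\mu_1,\dots,\mu_n)$ with $0\le\mu_i\le L$ put $$Y^{(L)}_\mu(x_1,\dots,x_n;q)=\operatorname{Tr}\Big(X^{(L)}_{\mu_1}(x_1)\cdots X^{(L)}_{\mu_n}(x_n)\,S^{(L)}\Big),$$ the trace being summed as a formal power series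 in $q$. **Theorem.** For every such $L$, $n$ and $\mu$, the trace converges formally, that is, for all $d\ge 0$ and every monomial $x^m$ only finitely many diagonal entries contain $x^mq^d$, and its value is a polynomial in $x_1,\dots,x_n$ with coefficients in $\mathbb Z[t][[q]]$. Let $$T_i=t-\frac{t x_i-x_{i+1}}{x_i-x_{i+1}}(1-s_i),\qquad 1\le i\le n-1,$$ where $s_i$ acts on polynomials by exchanging $x_i$ and $x_{i+1}$, and on compositions by exchanging $\mu_i$ and $\mu_{i+1}$. Then for all $1\le i\le n-1$ $$T_iY^{(L)}_\mu=t\,Y^{(L)}_\mu\quad\text{if }\mu_i=\mu_{i+1},\qquad T_iY^{(L)}_\mu=Y^{(L)}_{s_i\mu}\quad\text{if }\mu_i>\mu_{i+1},$$ and $$q^{\mu_n}\,Y^{(L)}_{(\mu_1,\dots,\mu_n)}(x_1,\dots,x_n;q)=Y^{(L)}_{(\mu_n,\mu_1,\dots,\mu_{n-1})}(q x_n,x_1,\dots,x_{n-1};q).$$ -/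

import Mathlib

open scoped Kronecker

noncomputable section

namespace MatrixAnsatz

section Matrices

variable {R : Type*} [CommRing R]

/-- The semi-infinite identity matrix. -/
def matI : Matrix ℕ ℕ R := Matrix.of fun i j => if i = j then 1 else 0

/-- The semi-infinite diagonal matrix with entries `t ^ i`. -/
def matA (t : R) : Matrix ℕ ℕ R := Matrix.of fun i j => if i = j then t ^ i else 0

/-- The semi-infinite matrix with entries `1` on the first superdiagonal. -/
def matEps : Matrix ℕ ℕ R := Matrix.of fun i j => if i + 1 = j then 1 else 0

/-- The semi-infinite matrix with entries `1 - t ^ i` at the positions `(i, i - 1)`. -/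
def matDelta (t : R) : Matrix ℕ ℕ R := Matrix.of fun i j => if i = j + 1 then 1 - t ^ i else 0

/-- The semi-infinite diagonal matrix `D(u)` with entries `u ^ i`. -/
def matD (u : R) : Matrix ℕ ℕ R := Matrix.of fun i j => if i = j then u ^ i else 0

/-- The tensor product `f 0 ⊗ f 1 ⊗ ⋯ ⊗ f (k - 1)` of semi-infinite matrices. -/
def tensor {k : ℕ} (f : Fin k → Matrix ℕ ℕ R) : Matrix (Fin k → ℕ) (Fin k → ℕ) R :=
  Matrix.of fun r c => ∏ p, f p (r p) (c p)

/-- The Prolhac–Evans–Mallick matrix `a_{JM}^{(L)}`, where `L = k + 1`; it has `L - 1 = k` tensor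
factors, and the factor with index `p : Fin k` is the one in position `p + 1`. The index ranges
are `0 ≤ J ≤ L` and `0 ≤ M < L` (the value is `0` outside of them). Here the classes are in the
order of Prolhac, Evans and Mallick: class `1` is the strongest, class `L` the weakest, and `0` is
the hole. -/
def pemMatrix (t : R) (k J M : ℕ) : Matrix (Fin k → ℕ) (Fin k → ℕ) R :=
  if 0 < J ∧ J < M ∧ M < k + 1 then
    tensor fun p => if p.val + 1 < J then matA t else if p.val + 1 = J then matDelta t
      else if p.val + 1 = M then matEps else matI
  else if J = 0 ∧ 0 < M ∧ M < k + 1 then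
    tensor fun p => if p.val + 1 = M then matEps else matI
  else if 0 < J ∧ J = M ∧ J < k + 1 then
    tensor fun p => if p.val + 1 < J then matA t else matI
  else if J = 0 ∧ M = 0 then
    tensor fun _ => matI
  else if 0 < J ∧ J < k + 1 ∧ M = 0 then
    tensor fun p => if p.val + 1 < J then matA t else if p.val + 1 = J then matDelta t else matI
  else if J = k + 1 ∧ M = 0 then
    tensor fun _ => matA t
  else 0

/-- The inhomogeneous matrix `a_{JM}^{(L)}(x)`, with `L = k + 1`. -/
def pemMatrixX (t : R) (k J M : ℕ) (x : R) : Matrix (Fin k → ℕ) (Fin k → ℕ) R :=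
  if 0 < J then x • pemMatrix t k J M else pemMatrix t k J M

/-- The order-reversing relabelling of the particle classes `1, …, L`, fixing the hole `0`. -/
def rev (L J : ℕ) : ℕ := if J = 0 then 0 else L + 1 - J

/-- The index set of the rows and columns of `X_J^{(L)}`, which has
`(L - 1) + (L - 2) + ⋯ + 1` tensor factors (the value at `L = 0` is not used). -/
abbrev State : ℕ → Type
  | 0 => Unit
  | 1 => Unit
  | k + 2 => (Fin (k + 1) → ℕ) × State (k + 1)

/-- The matrices `X_J^{(L)}(x)`, with `0 ≤ J ≤ L` and `L ≥ 1` (the value at `L = 0` is not used).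
The classes are in the order in which `L` is the strongest, which is why the recursion
`X_J^{(L)}(x) = ∑ a_{J* M*}^{(L)}(x) ⊗ X_{max(0, M - 1)}^{(L - 1)}(x)`, with the sum over `M` in
`{0, 2, 3, …, L}`, passes to the reversed labels `J* = rev L J` and `M* = rev L M`. -/
def matX (t : R) : (L : ℕ) → ℕ → R → Matrix (State L) (State L) R
  | 0, _, _ => 0
  | 1, J, x => Matrix.of fun _ _ => if J = 0 then 1 else if J = 1 then x else 0
  | k + 2, J, x =>
    ∑ M ∈ (Finset.range (k + 3)).erase 1,
      (pemMatrixX t (k + 1) (rev (k + 2) J) (rev (k + 2) M) x ⊗ₖ matX t (k + 1) (M - 1) x)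

/-- The twist `S^{(L)} = s^{(L)} ⊗ ⋯ ⊗ s^{(1)}`, where `s^{(1)} = 1` and
`s^{(L)} = D(q ^ (L - 1)) ⊗ ⋯ ⊗ D(q ^ 2) ⊗ D(q)`. -/
def matS (q : R) : (L : ℕ) → Matrix (State L) (State L) R
  | 0 => 0
  | 1 => Matrix.of fun _ _ => 1
  | k + 2 => (tensor fun p : Fin (k + 1) => matD (q ^ (k + 1 - p.val))) ⊗ₖ matS q (k + 1)

/-- The product of infinite matrices. (All matrices multiplied here have finitely many nonzero
entries in each row and each column, so that the sums are finite.) -/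
def infMul {σ : Type*} (M N : Matrix σ σ R) : Matrix σ σ R :=
  Matrix.of fun i j => ∑ᶠ k, M i k * N k j

open Classical in
/-- The ordered product `M 0 * M 1 * ⋯ * M (n - 1)` of infinite matrices. -/
def infProd {σ : Type*} {n : ℕ} (M : Fin n → Matrix σ σ R) : Matrix σ σ R :=
  (List.ofFn M).foldr infMul (1 : Matrix σ σ R)

end Matrices

/-- The ring `ℤ[t]⟦q⟧[x_1, …, x_n]`. -/
abbrev PolyRing (n : ℕ) : Type := MvPolynomial (Fin n) (PowerSeries (Polynomial ℤ))

/-- The parameter `t`. -/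
def tt (n : ℕ) : PolyRing n := MvPolynomial.C (PowerSeries.C Polynomial.X)

/-- The parameter `q`. -/
def qq (n : ℕ) : PolyRing n := MvPolynomial.C PowerSeries.X

/-- `HasFormalTrace M f` says that the sum of the diagonal entries of the infinite matrix `M`
converges formally to `f`: for every monomial `x ^ m * q ^ d`, only finitely many diagonal entries
contain it, and its coefficients in these entries (polynomials in `t`) add up to that in `f`. -/
def HasFormalTrace {σ : Type*} {n : ℕ} (M : Matrix σ σ (PolyRing n)) (f : PolyRing n) : Prop :=
  ∀ (m : Fin n →₀ ℕ) (d : ℕ),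
    {s : σ | PowerSeries.coeff d (MvPolynomial.coeff m (M s s)) ≠ 0}.Finite ∧
    PowerSeries.coeff d (MvPolynomial.coeff m f) =
      ∑ᶠ s : σ, PowerSeries.coeff d (MvPolynomial.coeff m (M s s))

open Classical in
/-- The formal trace of an infinite matrix (`0` if the trace does not exist). -/
def formalTrace {σ : Type*} {n : ℕ} (M : Matrix σ σ (PolyRing n)) : PolyRing n :=
  if h : ∃ f, HasFormalTrace M f then h.choose else 0

/-- The matrix `X_{μ_1}^{(L)}(x_1) ⋯ X_{μ_n}^{(L)}(x_n) S^{(L)}`. -/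
def ansatzProduct {n : ℕ} (L : ℕ) (μ : Fin n → ℕ) : Matrix (State L) (State L) (PolyRing n) :=
  infMul (infProd fun i => matX (tt n) L (μ i) (MvPolynomial.X i)) (matS (qq n) L)

/-- The trace `Y_μ^{(L)}(x_1, …, x_n; q)`. -/
def traceY {n : ℕ} (L : ℕ) (μ : Fin n → ℕ) : PolyRing n :=
  formalTrace (ansatzProduct L μ)

/-- The embedding of the polynomials into their field of fractions. -/
def toFrac {n : ℕ} (f : PolyRing n) : FractionRing (PolyRing n) :=
  algebraMap (PolyRing n) (FractionRing (PolyRing n)) f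

/-- The Hecke operator `T_i = t - (t x_i - x_{i+1}) / (x_i - x_{i+1}) * (1 - s_i)` on polynomials
in `x_1, …, x_{m+1}`, with value in the field of fractions; `s_i` exchanges `x_i` and `x_{i+1}`. -/
def heckeT {m : ℕ} (i : Fin m) (f : PolyRing (m + 1)) : FractionRing (PolyRing (m + 1)) :=
  toFrac (tt (m + 1)) * toFrac f -
    (toFrac (tt (m + 1)) * toFrac (MvPolynomial.X i.castSucc) - toFrac (MvPolynomial.X i.succ)) /
      (toFrac (MvPolynomial.X i.castSucc) - toFrac (MvPolynomial.X i.succ)) *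
      (toFrac f - toFrac (MvPolynomial.rename (Equiv.swap i.castSucc i.succ) f))

/-- The shift `f(x_1, …, x_n) ↦ f(q x_n, x_1, …, x_{n-1})`, with `n = m + 1`. -/
def shift {m : ℕ} (f : PolyRing (m + 1)) : PolyRing (m + 1) :=
  MvPolynomial.aeval
    (Fin.cons (qq (m + 1) * MvPolynomial.X (Fin.last m))
      (fun k : Fin m => MvPolynomial.X k.castSucc) : Fin (m + 1) → PolyRing (m + 1)) f

/-- The composition `(μ_n, μ_1, …, μ_{n-1})`, with `n = m + 1`. -/
def rotate {m : ℕ} (μ : Fin (m + 1) → ℕ) : Fin (m + 1) → ℕ :=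
  Fin.cons (μ (Fin.last m)) fun k : Fin m => μ k.castSucc

end MatrixAnsatz

end

open MatrixAnsatz

open scoped Kronecker

noncomputable section

namespace MatrixAnsatz

/-! ### Products of row-finite infinite matrices -/

section RowFinite

variable {R : Type*} [CommRing R] {σ τ : Type*}

/-! Both families of relations come from relations between the matrices $X_J(x)=X^{(L)}_J(x)$.

Hecke relations: the matrices satisfy $(tx-y)X_a(y)X_b(x)=D\,X_a(x)X_b(y)+E\,X_b(x)X_a(y)$, where
$D,E$ depend on $a,b$ only through their order (`matX_exchange`). At two adjacent places of the
trace this expresses $s_iY_\mu$ through $Y_\mu$ and $Y_{s_i\mu}$, which is the action of $T_i$ after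
clearing denominators. The matrix relation is proved by induction on $L$: the relation of level
$L-1$ exchanges the second tensor factors, and `pemMatrixX_exchange` trades the resulting
coefficients, indexed by the summation labels, for those indexed by $a,b$. An entry $(r,c)$ of
$a_{JM}$ vanishes unless $r+e_M=c+e_J$, so all products in that relation share one selection rule,
and what remains is the scalar identity `pemWeight_exchange`, checked for every order type of the
four labels.

Cyclic relation: the selection rule also yields $S\,X_J(qx)=q^J X_J(x)\,S$ (`twist_matX`), and the
trace is cyclic (`IsTwistedSum.cyclic`).

Convergence: a diagonal entry is $q^{w(s)}$ times a polynomial of degree at most $nL$ in the $x_i$,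
and only finitely many states $s$ have $w(s)\le d$. Hence the trace is a $q$-adic limit that is
polynomial in the $x_i$, and identities between traces are verified modulo every power of $q$ on
finite sums. -/

/-- Every row of the infinite matrix has only finitely many nonzero entries. -/
def RowFinite (M : Matrix σ τ R) : Prop := ∀ i, (Function.support (M i)).Finite

theorem infMul_apply_eq_sum {A B : Matrix σ σ R} {i : σ} (S : Finset σ)
    (hS : Function.support (A i) ⊆ S) (j : σ) :
    infMul A B i j = ∑ k ∈ S, A i k * B k j := by
  refine finsum_eq_sum_of_support_subset _ fun k hk => hS ?_
  simp only [Function.mem_support] at hk ⊢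
  exact fun h => hk (by rw [h, zero_mul])

theorem RowFinite.exists_finset {A : Matrix σ σ R} (hA : RowFinite A) (i : σ) :
    ∃ S : Finset σ, Function.support (A i) ⊆ S :=
  ⟨(hA i).toFinset, by simp⟩

theorem RowFinite.infMul {A B : Matrix σ σ R} (hA : RowFinite A) (hB : RowFinite B) :
    RowFinite (infMul A B) := by
  intro i
  obtain ⟨S, hS⟩ := hA.exists_finset i
  refine (S.finite_toSet.biUnion fun k _ => hB k).subset fun j hj => ?_
  rw [Function.mem_support, infMul_apply_eq_sum S hS] at hj
  obtain ⟨k, hk, hne⟩ := Finset.exists_ne_zero_of_sum_ne_zero hj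
  simp only [Set.mem_iUnion]
  exact ⟨k, hk, fun h => hne (by rw [h, mul_zero])⟩

theorem RowFinite.one [DecidableEq σ] : RowFinite (1 : Matrix σ σ R) := by
  intro i
  refine (Set.finite_singleton i).subset fun j hj => ?_
  by_contra h
  exact hj (Matrix.one_apply_ne fun h' => h h'.symm)

theorem RowFinite.add {A B : Matrix σ τ R} (hA : RowFinite A) (hB : RowFinite B) :
    RowFinite (A + B) := fun i =>
  ((hA i).union (hB i)).subset (Function.support_add (A i) (B i))

theorem RowFinite.smul {A : Matrix σ τ R} (hA : RowFinite A) (c : R) : RowFinite (c • A) :=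
  fun i => (hA i).subset fun j hj h => hj (by simp [h])

theorem RowFinite.sum {ι : Type*} (s : Finset ι) {A : ι → Matrix σ τ R}
    (hA : ∀ i ∈ s, RowFinite (A i)) : RowFinite (∑ i ∈ s, A i) := by
  classical
  induction s using Finset.induction_on with
  | empty => exact fun i => Set.finite_empty.subset fun j hj => hj rfl
  | insert a s ha ih =>
    rw [Finset.sum_insert ha]
    exact (hA a (by simp)).add (ih fun i hi => hA i (by simp [hi]))

theorem RowFinite.kronecker {σ' τ' : Type*} {A : Matrix σ τ R} {B : Matrix σ' τ' R}
    (hA : RowFinite A) (hB : RowFinite B) : RowFinite (A ⊗ₖ B) := by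
  rintro ⟨i, i'⟩
  refine ((hA i).prod (hB i')).subset ?_
  rintro ⟨j, j'⟩ h
  simp only [Function.mem_support, Matrix.kroneckerMap_apply] at h
  exact ⟨left_ne_zero_of_mul h, right_ne_zero_of_mul h⟩

theorem one_infMul [DecidableEq σ] (A : Matrix σ σ R) : infMul 1 A = A := by
  ext i j
  rw [infMul_apply_eq_sum {i}]
  · simp
  · intro k hk
    by_contra h
    exact hk (Matrix.one_apply_ne fun h' => h (by simp [h']))

theorem infMul_one [DecidableEq σ] (A : Matrix σ σ R) : infMul A 1 = A := by
  ext i j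
  change ∑ᶠ k, A i k * (1 : Matrix σ σ R) k j = A i j
  rw [finsum_eq_single _ j]
  · simp
  · intro k hk
    simp [Matrix.one_apply_ne hk]

/-- Starting from row `i`, only finitely many intermediate indices are reached, so both sides are
the same finite double sum. Without row-finiteness `finsum` may default to `0`. -/
theorem infMul_assoc {A B : Matrix σ σ R} (C : Matrix σ σ R) (hA : RowFinite A)
    (hB : RowFinite B) : infMul (infMul A B) C = infMul A (infMul B C) := by
  classical
  ext i j
  obtain ⟨S, hS⟩ := hA.exists_finset i
  choose T hT using hB.exists_finset
  have hk : ∀ k ∈ S, infMul B C k j = ∑ l ∈ S.biUnion T, B k l * C l j := fun k hk =>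
    infMul_apply_eq_sum _ ((hT k).trans fun l hl => by
      simp only [Finset.coe_biUnion, Set.mem_iUnion]
      exact ⟨k, hk, hl⟩) j
  have hAB : Function.support (infMul A B i) ⊆ S.biUnion T := by
    intro l hl
    rw [Function.mem_support, infMul_apply_eq_sum S hS] at hl
    obtain ⟨k, hk, hne⟩ := Finset.exists_ne_zero_of_sum_ne_zero hl
    simp only [Finset.coe_biUnion, Set.mem_iUnion]
    exact ⟨k, hk, hT k fun h => hne (by rw [h, mul_zero])⟩
  have hAC : ∑ k ∈ S, A i k * infMul B C k j =
      ∑ k ∈ S, A i k * ∑ l ∈ S.biUnion T, B k l * C l j :=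
    Finset.sum_congr rfl fun k h => by rw [hk k h]
  rw [infMul_apply_eq_sum _ hAB, infMul_apply_eq_sum S hS, hAC]
  simp only [infMul_apply_eq_sum S hS, Finset.sum_mul, Finset.mul_sum, mul_assoc]
  exact Finset.sum_comm

theorem infMul_add {A : Matrix σ σ R} (B C : Matrix σ σ R) (hA : RowFinite A) :
    infMul A (B + C) = infMul A B + infMul A C := by
  ext i j
  obtain ⟨S, hS⟩ := hA.exists_finset i
  simp only [Matrix.add_apply, infMul_apply_eq_sum S hS, mul_add, Finset.sum_add_distrib]

theorem infMul_smul (c : R) {A : Matrix σ σ R} (B : Matrix σ σ R) (hA : RowFinite A) :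
    infMul A (c • B) = c • infMul A B := by
  ext i j
  obtain ⟨S, hS⟩ := hA.exists_finset i
  simp only [Matrix.smul_apply, infMul_apply_eq_sum S hS, smul_eq_mul, Finset.mul_sum]
  exact Finset.sum_congr rfl fun k _ => by ring

theorem add_infMul {A B : Matrix σ σ R} (C : Matrix σ σ R) (hA : RowFinite A)
    (hB : RowFinite B) : infMul (A + B) C = infMul A C + infMul B C := by
  classical
  ext i j
  obtain ⟨S, hS⟩ := hA.exists_finset i
  obtain ⟨T, hT⟩ := hB.exists_finset i
  have hS' : Function.support (A i) ⊆ ↑(S ∪ T) := hS.trans (by simp)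
  have hT' : Function.support (B i) ⊆ ↑(S ∪ T) := hT.trans (by simp)
  have hST : Function.support ((A + B) i) ⊆ ↑(S ∪ T) :=
    (Function.support_add (A i) (B i)).trans (Set.union_subset hS' hT')
  simp only [Matrix.add_apply, infMul_apply_eq_sum _ hS', infMul_apply_eq_sum _ hT',
    infMul_apply_eq_sum _ hST, add_mul, Finset.sum_add_distrib]

theorem smul_infMul (c : R) {A : Matrix σ σ R} (B : Matrix σ σ R) (hA : RowFinite A) :
    infMul (c • A) B = c • infMul A B := by
  ext i j
  obtain ⟨S, hS⟩ := hA.exists_finset i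
  have hS' : Function.support ((c • A) i) ⊆ ↑S := fun k hk => hS fun h => hk (by simp [h])
  simp only [Matrix.smul_apply, infMul_apply_eq_sum S hS, infMul_apply_eq_sum S hS', smul_eq_mul,
    Finset.mul_sum, mul_assoc]

theorem infMul_sum {ι : Type*} (s : Finset ι) {A : Matrix σ σ R} (B : ι → Matrix σ σ R)
    (hA : RowFinite A) : infMul A (∑ i ∈ s, B i) = ∑ i ∈ s, infMul A (B i) := by
  ext i j
  obtain ⟨S, hS⟩ := hA.exists_finset i
  simp only [Matrix.sum_apply, infMul_apply_eq_sum S hS, Finset.mul_sum]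
  exact Finset.sum_comm

theorem sum_infMul {ι : Type*} (s : Finset ι) {A : ι → Matrix σ σ R} (B : Matrix σ σ R)
    (hA : ∀ i ∈ s, RowFinite (A i)) :
    infMul (∑ i ∈ s, A i) B = ∑ i ∈ s, infMul (A i) B := by
  classical
  induction s using Finset.induction_on with
  | empty =>
    ext i j
    simp [infMul]
  | insert a s ha ih =>
    rw [Finset.sum_insert ha, Finset.sum_insert ha, add_infMul _ (hA a (by simp)),
      ih fun i hi => hA i (by simp [hi])]
    exact RowFinite.sum s fun i hi => hA i (by simp [hi])

theorem infMul_kronecker {A B : Matrix σ σ R} {C D : Matrix τ τ R} (hA : RowFinite A)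
    (hC : RowFinite C) : infMul (A ⊗ₖ C) (B ⊗ₖ D) = infMul A B ⊗ₖ infMul C D := by
  ext ⟨i, i'⟩ ⟨j, j'⟩
  obtain ⟨S, hS⟩ := hA.exists_finset i
  obtain ⟨T, hT⟩ := hC.exists_finset i'
  have hST : Function.support ((A ⊗ₖ C) (i, i')) ⊆ ↑(S ×ˢ T) := by
    rintro ⟨k, k'⟩ h
    simp only [Function.mem_support, Matrix.kroneckerMap_apply] at h
    simp only [Finset.coe_product]
    exact ⟨hS (left_ne_zero_of_mul h), hT (right_ne_zero_of_mul h)⟩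
  simp only [Matrix.kroneckerMap_apply, infMul_apply_eq_sum S hS, infMul_apply_eq_sum T hT,
    infMul_apply_eq_sum _ hST, Finset.sum_mul_sum, Finset.sum_product]
  exact Finset.sum_congr rfl fun k _ => Finset.sum_congr rfl fun k' _ => by ring

theorem infMul_map {R' : Type*} [CommRing R'] (φ : R →+* R') {A : Matrix σ σ R}
    (B : Matrix σ σ R) (hA : RowFinite A) :
    (infMul A B).map φ = infMul (A.map φ) (B.map φ) := by
  ext i j
  obtain ⟨S, hS⟩ := hA.exists_finset i
  have hS' : Function.support ((A.map φ) i) ⊆ ↑S := fun k hk => hS fun h => hk (by simp [h])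
  simp only [Matrix.map_apply, infMul_apply_eq_sum S hS, infMul_apply_eq_sum S hS', map_sum,
    map_mul]

theorem infProd_zero [DecidableEq σ] (M : Fin 0 → Matrix σ σ R) : infProd M = 1 := by
  unfold infProd
  rw [List.ofFn_zero, List.foldr_nil]
  congr!

theorem infProd_succ {n : ℕ} (M : Fin (n + 1) → Matrix σ σ R) :
    infProd M = infMul (M 0) (infProd fun k : Fin n => M k.succ) := by
  unfold infProd
  rw [List.ofFn_succ, List.foldr_cons]

theorem RowFinite.infProd {n : ℕ} {M : Fin n → Matrix σ σ R} (hM : ∀ k, RowFinite (M k)) :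
    RowFinite (infProd M) := by
  classical
  induction n with
  | zero => rw [infProd_zero]; exact RowFinite.one
  | succ n ih => rw [infProd_succ]; exact (hM 0).infMul (ih fun k => hM _)

theorem infProd_succ_last {n : ℕ} {M : Fin (n + 1) → Matrix σ σ R} (hM : ∀ k, RowFinite (M k)) :
    infProd M = infMul (infProd fun k : Fin n => M k.castSucc) (M (Fin.last n)) := by
  classical
  induction n with
  | zero => rw [infProd_succ, infProd_zero, infProd_zero, infMul_one, one_infMul]; rfl
  | succ n ih =>
    rw [infProd_succ, ih fun k => hM _, infProd_succ (fun k : Fin (n + 1) => M k.castSucc),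
      infMul_assoc _ (hM _) (RowFinite.infProd fun k => hM _)]
    rfl

theorem infProd_map {R' : Type*} [CommRing R'] (φ : R →+* R') {n : ℕ}
    {M : Fin n → Matrix σ σ R} (hM : ∀ k, RowFinite (M k)) :
    (infProd M).map φ = infProd fun k => (M k).map φ := by
  classical
  induction n with
  | zero => simp only [infProd_zero]; exact Matrix.map_one _ (map_zero φ) (map_one φ)
  | succ n ih => rw [infProd_succ, infProd_succ, infMul_map φ _ (hM 0), ih fun k => hM _]

/-- A linear relation between products of two adjacent factors extends to the whole products. -/
theorem infProd_exchange {m : ℕ} (i : Fin m) (a b c : R) {M N P : Fin (m + 1) → Matrix σ σ R}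
    (hM : ∀ k, RowFinite (M k)) (hN : ∀ k, RowFinite (N k)) (hP : ∀ k, RowFinite (P k))
    (hMN : ∀ k, k ≠ i.castSucc → k ≠ i.succ → M k = N k)
    (hMP : ∀ k, k ≠ i.castSucc → k ≠ i.succ → M k = P k)
    (h : a • infMul (M i.castSucc) (M i.succ) =
      b • infMul (N i.castSucc) (N i.succ) + c • infMul (P i.castSucc) (P i.succ)) :
    a • infProd M = b • infProd N + c • infProd P := by
  induction m with
  | zero => exact i.elim0
  | succ m ih =>
    cases i using Fin.cases with
    | zero =>
      have key : ∀ Q : Fin (m + 2) → Matrix σ σ R, (∀ k, RowFinite (Q k)) →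
          infProd Q = infMul (infMul (Q 0) (Q 1)) (infProd fun k : Fin m => Q k.succ.succ) := by
        intro Q hQ
        rw [infMul_assoc _ (hQ _) (hQ _), infProd_succ, infProd_succ]
        rfl
      have hne : ∀ k : Fin m, k.succ.succ ≠ (0 : Fin (m + 1)).castSucc ∧
          k.succ.succ ≠ (0 : Fin (m + 1)).succ := fun k => by
        constructor <;> simp [Fin.ext_iff]
      have h1 : (fun k : Fin m => N k.succ.succ) = fun k : Fin m => M k.succ.succ :=
        funext fun k => (hMN _ (hne k).1 (hne k).2).symm
      have h2 : (fun k : Fin m => P k.succ.succ) = fun k : Fin m => M k.succ.succ :=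
        funext fun k => (hMP _ (hne k).1 (hne k).2).symm
      have h' : a • infMul (M 0) (M 1) = b • infMul (N 0) (N 1) + c • infMul (P 0) (P 1) := h
      have rM := (hM 0).infMul (hM 1)
      have rN := (hN 0).infMul (hN 1)
      have rP := (hP 0).infMul (hP 1)
      rw [key M hM, key N hN, key P hP, h1, h2, ← smul_infMul _ _ rM, ← smul_infMul _ _ rN,
        ← smul_infMul _ _ rP, ← add_infMul _ (rN.smul _) (rP.smul _), h']
    | succ j =>
      have h0 : (0 : Fin (m + 2)) ≠ j.succ.castSucc ∧ (0 : Fin (m + 2)) ≠ j.succ.succ := by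
        constructor <;> simp [Fin.ext_iff]
      have := ih j (M := fun k => M k.succ) (N := fun k => N k.succ) (P := fun k => P k.succ)
        (fun k => hM _) (fun k => hN _) (fun k => hP _)
        (fun k h1 h2 => hMN _ (fun h => h1 (Fin.succ_injective _ h))
          (fun h => h2 (Fin.succ_injective _ h)))
        (fun k h1 h2 => hMP _ (fun h => h1 (Fin.succ_injective _ h))
          (fun h => h2 (Fin.succ_injective _ h))) h
      rw [infProd_succ, infProd_succ N, infProd_succ P, ← hMN 0 h0.1 h0.2, ← hMP 0 h0.1 h0.2,
        ← infMul_smul _ _ (hM 0), ← infMul_smul _ _ (hM 0), ← infMul_smul _ _ (hM 0),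
        ← infMul_add _ _ (hM 0), this]

end RowFinite

/-! ### The scalar exchange identity -/

section Weights

variable {R : Type*} [CommRing R]

/-- The direct coefficient of the exchange relation for classes `a`, `b`, where class `1` is the
strongest and `0` is the weakest. -/
def pemDirect (t x y : R) (a b : ℕ) : R :=
  if a = b then t * x - y else if 0 < a ∧ (b = 0 ∨ a < b) then -(y * (1 - t)) else -(x * (1 - t))

/-- The exchange coefficient of the exchange relation for classes `a`, `b`, where class `1` is the
strongest and `0` is the weakest. -/
def pemExchange (t x y : R) (a b : ℕ) : R :=
  if a = b then 0 else if 0 < a ∧ (b = 0 ∨ a < b) then x - y else t * (x - y)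

/-- The nonzero entries of `pemMatrix`, in terms of the values `U p = t ^ i_p` and of their partial
products `P`. -/
def pemWeight (P U : ℕ → R) (J M : ℕ) : R :=
  if 0 < M ∧ M < J then 0 else P J * if J = M then 1 else 1 - U J

/-- The factor `x ^ [0 < J]` in the inhomogeneous matrices. -/
def fugacity (J : ℕ) (x : R) : R := if 0 < J then x else 1

variable {F : Type*} [Field F]

/-- The change of the value `t ^ i_p` when `M` arrives and `J` departs. -/
def moveSite (t : F) (M J : ℕ) (U : ℕ → F) (p : ℕ) : F :=
  U p * (if p = M then t else 1) * (if p = J then t⁻¹ else 1)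

/-- The change of the partial products of the values `t ^ i_p` when `M` arrives and `J` departs. -/
def movePartial (t : F) (M J : ℕ) (P : ℕ → F) (K : ℕ) : F :=
  P K * (if 0 < M ∧ M < K then t else 1) * (if 0 < J ∧ J < K then t⁻¹ else 1)

set_option maxHeartbeats 8000000 in
/-- The exchange relation of the Prolhac–Evans–Mallick matrices, on the level of entries. -/
theorem pemWeight_exchange {t : F} (ht : t ≠ 0) (x y : F) (P U : ℕ → F)
    (hP : P 0 = 1) (hU : U 0 = 0) (J K M N : ℕ) :
    pemDirect t x y M N * (fugacity J y * fugacity K x * (pemWeight P U J M *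
        pemWeight (movePartial t M J P) (moveSite t M J U) K N)) +
      pemExchange t x y N M * (fugacity J y * fugacity K x * (pemWeight P U J N *
        pemWeight (movePartial t N J P) (moveSite t N J U) K M)) =
    pemDirect t x y J K * (fugacity J x * fugacity K y * (pemWeight P U J M *
        pemWeight (movePartial t M J P) (moveSite t M J U) K N)) +
      pemExchange t x y J K * (fugacity K x * fugacity J y * (pemWeight P U K M *
        pemWeight (movePartial t M K P) (moveSite t M K U) J N)) := by
  simp only [pemDirect, pemExchange, pemWeight, moveSite, movePartial, fugacity]
  -- The label `0` is the weakest class although it is the least number, so comparisons with `0` are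
  -- split off as well. In each order type all conditionals resolve, and a rational identity in `t`,
  -- `x`, `y` and free values of `P` and `U` remains.
  have zero_or : ∀ a : ℕ, a = 0 ∨ 0 < a := fun a => by omega
  obtain hJ | hJ := zero_or J
  all_goals obtain hK | hK := zero_or K
  all_goals obtain hM | hM := zero_or M
  all_goals obtain hN | hN := zero_or N
  all_goals obtain hJK | hJK | hJK := lt_trichotomy J K
  all_goals try (exfalso; omega)
  all_goals obtain hJM | hJM | hJM := lt_trichotomy J M
  all_goals try (exfalso; omega)
  all_goals obtain hJN | hJN | hJN := lt_trichotomy J N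
  all_goals try (exfalso; omega)
  all_goals obtain hKM | hKM | hKM := lt_trichotomy K M
  all_goals try (exfalso; omega)
  all_goals obtain hKN | hKN | hKN := lt_trichotomy K N
  all_goals try (exfalso; omega)
  all_goals obtain hMN | hMN | hMN := lt_trichotomy M N
  all_goals try (exfalso; omega)
  all_goals
    simp (disch := omega) only [if_pos, if_neg]
    subst_vars
    try simp only [hP, hU]
    try field_simp
    try ring
end Weights

/-! ### Entries of the Prolhac–Evans–Mallick matrices -/

section Entries

variable {R : Type*} [CommRing R] {k : ℕ}

/-- The unit vector in position `J`, where the positions are `1, …, k`. -/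
def unitAt (k J : ℕ) : Fin k → ℕ := fun p => if p.val + 1 = J then 1 else 0

/-- The product of the values in the positions before `J`. -/
def partialProd (u : Fin k → R) (J : ℕ) : R := ∏ p, if p.val + 1 < J then u p else 1

/-- The value in position `J`, and `0` if `J` is not among `1, …, k`. -/
def siteValue (u : Fin k → R) (J : ℕ) : R :=
  if h : 0 < J ∧ J ≤ k then u ⟨J - 1, by omega⟩ else 0

/-- For `J = 0` and `J = k + 1` there is no factor $\delta$; the default `0` of `siteValue` then
gives the correct factor `1`. -/
theorem prod_ite_site (u : Fin k → R) (J : ℕ) :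
    ∏ p : Fin k, (if p.val + 1 = J then 1 - u p else 1) = 1 - siteValue u J := by
  unfold siteValue
  split_ifs with h
  · rw [Finset.prod_eq_single ⟨J - 1, by omega⟩]
    · rw [if_pos (by simp only; omega)]
    · intro p _ hp
      rw [if_neg]
      exact fun h' => hp (Fin.ext (by simp only; omega))
    · simp
  · rw [sub_zero]
    refine Finset.prod_eq_one fun p _ => if_neg ?_
    have := p.isLt
    omega

theorem tensor_apply_of_site {t : R} {J M : ℕ} (hJM : ¬(0 < M ∧ M < J))
    {f : Fin k → Matrix ℕ ℕ R} (r c : Fin k → ℕ)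
    (hf : ∀ p, f p (r p) (c p) = if r p + unitAt k M p = c p + unitAt k J p then
      (if p.val + 1 < J then t ^ r p else 1) *
        (if J = M then 1 else if p.val + 1 = J then 1 - t ^ r p else 1) else 0) :
    tensor f r c = if r + unitAt k M = c + unitAt k J then
      pemWeight (partialProd fun p => t ^ r p) (siteValue fun p => t ^ r p) J M else 0 := by
  have hc : (r + unitAt k M = c + unitAt k J) ↔
      ∀ p ∈ Finset.univ, r p + unitAt k M p = c p + unitAt k J p := by
    simp [funext_iff]
  simp only [tensor, Matrix.of_apply, hf, hc, Finset.prod_ite_zero, pemWeight, if_neg hJM,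
    Finset.prod_mul_distrib, partialProd]
  split_ifs
  · simp
  · rw [prod_ite_site (fun p => t ^ r p)]
  · rfl

/-- The factor $\epsilon$ raises the index in position `M`, $\delta$ lowers it in position `J`, and
$A$ and $I$ are diagonal. With the defaults at `0` and `k + 1` this puts all cases of the definition
under one formula. -/
theorem pemMatrix_apply (t : R) {J M : ℕ} (hJ : J ≤ k + 1) (hM : M ≤ k) (r c : Fin k → ℕ) :
    pemMatrix t k J M r c = if r + unitAt k M = c + unitAt k J then
      pemWeight (partialProd fun p => t ^ r p) (siteValue fun p => t ^ r p) J M else 0 := by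
  by_cases hJM : 0 < M ∧ M < J
  · have h : pemMatrix t k J M = 0 := by
      unfold pemMatrix
      simp (disch := omega) only [if_neg]
    rw [h, pemWeight, if_pos hJM, ite_self]
    rfl
  · have key := fun (f : Fin k → Matrix ℕ ℕ R) hf =>
      tensor_apply_of_site (t := t) hJM (f := f) r c hf
    -- The right side is made opaque so that `split_ifs` only sees the cases of `pemMatrix`.
    generalize (if r + unitAt k M = c + unitAt k J then
      pemWeight (partialProd fun p => t ^ r p) (siteValue fun p => t ^ r p) J M else 0) = z
      at key ⊢
    unfold pemMatrix
    split_ifs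
    all_goals first | omega | refine key _ fun p => ?_
    all_goals
      have := p.isLt
      simp only [unitAt]
      split_ifs
    all_goals first
      | omega
      | (simp only [matA, matDelta, matEps, matI, Matrix.of_apply]
         simp (disch := omega) only [if_pos, if_neg, mul_one, one_mul])

theorem rowFinite_pemMatrix (t : R) {J M : ℕ} (hJ : J ≤ k + 1) (hM : M ≤ k) :
    RowFinite (pemMatrix t k J M) := by
  intro r
  refine (Set.finite_singleton (fun p => r p + unitAt k M p - unitAt k J p)).subset fun c hc => ?_
  rw [Function.mem_support, pemMatrix_apply t hJ hM] at hc
  rw [Set.mem_singleton_iff]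
  funext p
  have := congrFun (not_not.mp fun h => hc (if_neg h)) p
  simp only [Pi.add_apply] at this
  omega

theorem pemMatrixX_eq (t : R) (J M : ℕ) (x : R) :
    pemMatrixX t k J M x = fugacity J x • pemMatrix t k J M := by
  unfold pemMatrixX fugacity
  split_ifs <;> simp

end Entries

/-! ### Exchange relation of the Prolhac–Evans–Mallick matrices -/

section Exchange

variable {F : Type*} [Field F] {k : ℕ}

/-- The change of the values `t ^ i_p` when `M` arrives and `J` departs. -/
def moveVec (t : F) (M J : ℕ) (u : Fin k → F) : Fin k → F :=
  fun p => u p * (if p.val + 1 = M then t else 1) * (if p.val + 1 = J then t⁻¹ else 1)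

theorem siteValue_moveVec (t : F) (M J : ℕ) (u : Fin k → F) :
    siteValue (moveVec t M J u) = moveSite t M J (siteValue u) := by
  funext K
  unfold siteValue moveSite moveVec
  by_cases h : 0 < K ∧ K ≤ k
  · have hK : K - 1 + 1 = K := by omega
    simp only [dif_pos h, hK]
  · simp only [dif_neg h, zero_mul]

theorem prod_ite_lt (a : F) {J K : ℕ} (hK : K ≤ k + 1) :
    ∏ p : Fin k, (if p.val + 1 < K then if p.val + 1 = J then a else 1 else 1) =
      if 0 < J ∧ J < K then a else 1 := by
  split_ifs with h
  · rw [Finset.prod_eq_single ⟨J - 1, by omega⟩]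
    · rw [if_pos (by simp only; omega), if_pos (by simp only; omega)]
    · intro p _ hp
      rw [if_neg (show ¬p.val + 1 = J from fun h' => hp (Fin.ext (by simp only; omega))), ite_self]
    · simp
  · refine Finset.prod_eq_one fun p _ => ?_
    split_ifs <;> first | omega | rfl

/-- For `K ≤ k + 1` every label strictly between `0` and `K` is an actual position, so a change
there does affect the product. -/
theorem partialProd_moveVec (t : F) {M J K : ℕ} (hK : K ≤ k + 1) (u : Fin k → F) :
    partialProd (moveVec t M J u) K = movePartial t M J (partialProd u) K := by
  unfold movePartial
  rw [← prod_ite_lt t (J := M) hK, ← prod_ite_lt t⁻¹ (J := J) hK]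
  unfold partialProd moveVec
  rw [← Finset.prod_mul_distrib, ← Finset.prod_mul_distrib]
  refine Finset.prod_congr rfl fun p _ => ?_
  split_ifs <;> simp

/-- The row determines the only possible intermediate state. The formula also covers the case where
that state would have a negative entry, because the first weight then vanishes. -/
theorem infMul_pemMatrix_apply {t : F} (ht : t ≠ 0) {J K M N : ℕ} (hJ : J ≤ k + 1)
    (hK : K ≤ k + 1) (hM : M ≤ k) (hN : N ≤ k) (r c : Fin k → ℕ) :
    infMul (pemMatrix t k J M) (pemMatrix t k K N) r c =
      if r + (unitAt k M + unitAt k N) = c + (unitAt k J + unitAt k K) then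
        pemWeight (partialProd fun p => t ^ r p) (siteValue fun p => t ^ r p) J M *
          pemWeight (movePartial t M J (partialProd fun p => t ^ r p))
            (moveSite t M J (siteValue fun p => t ^ r p)) K N
      else 0 := by
  by_cases hs : ∃ s, r + unitAt k M = s + unitAt k J
  · obtain ⟨s, hs⟩ := hs
    have hs' : (fun p => t ^ s p) = moveVec t M J fun p => t ^ r p := by
      funext p
      have := congrFun hs p
      simp only [Pi.add_apply, unitAt] at this
      simp only [moveVec]
      split_ifs at this ⊢
      · rw [show s p = r p by omega]; field_simp
      · rw [show s p = r p + 1 by omega]; field_simp; ring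
      · rw [show r p = s p + 1 by omega]; field_simp; ring
      · rw [show s p = r p by omega]; ring
    have hw : pemWeight (partialProd fun p => t ^ s p) (siteValue fun p => t ^ s p) K N =
        pemWeight (movePartial t M J (partialProd fun p => t ^ r p))
            (moveSite t M J (siteValue fun p => t ^ r p)) K N := by
      unfold pemWeight
      rw [hs', partialProd_moveVec t hK, siteValue_moveVec]
    have hcond : (s + unitAt k N = c + unitAt k K) ↔
        r + (unitAt k M + unitAt k N) = c + (unitAt k J + unitAt k K) := by
      simp only [funext_iff, Pi.add_apply] at hs ⊢
      refine forall_congr' fun p => ?_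
      have := hs p
      omega
    rw [infMul_apply_eq_sum {s}]
    · rw [Finset.sum_singleton, pemMatrix_apply t hJ hM, if_pos hs, pemMatrix_apply t hK hN, hw]
      simp only [hcond, mul_ite, mul_zero]
    · intro s' h
      rw [Function.mem_support, pemMatrix_apply t hJ hM] at h
      have h' : r + unitAt k M = s' + unitAt k J := by
        by_contra h'
        exact h (if_neg h')
      simpa using add_right_cancel (h'.symm.trans hs)
  · have hz : pemMatrix t k J M r = 0 := by
      funext s
      rw [pemMatrix_apply t hJ hM, if_neg fun h => hs ⟨s, h⟩]
      rfl
    -- The intermediate state can only fail to exist if `J` departs from an empty position; then the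
    -- factor of $\delta$ is $1-t^0=0$.
    have hw : pemWeight (partialProd fun p => t ^ r p) (siteValue fun p => t ^ r p) J M = 0 := by
      by_contra hne
      apply hs
      refine ⟨fun p => r p + unitAt k M p - unitAt k J p, funext fun p => ?_⟩
      simp only [Pi.add_apply]
      by_contra hp
      have hpJ : p.val + 1 = J ∧ p.val + 1 ≠ M ∧ r p = 0 := by
        simp only [unitAt] at hp
        split_ifs at hp <;> omega
      apply hne
      have hv : siteValue (fun p => t ^ r p) J = 1 := by
        have h1 := p.isLt
        have h2 : (⟨J - 1, by omega⟩ : Fin k) = p := Fin.ext (by simp only; omega)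
        rw [siteValue, dif_pos (by omega), h2, hpJ.2.2, pow_zero]
      rw [pemWeight, hv, if_neg (show J ≠ M by omega), sub_self, mul_zero, ite_self]
    rw [hw, zero_mul, ite_self]
    refine finsum_eq_zero_of_forall_eq_zero fun s => ?_
    rw [hz, Pi.zero_apply, zero_mul]

/-- The exchange relation of the Prolhac–Evans–Mallick matrices. -/
theorem pemMatrixX_exchange {t : F} (ht : t ≠ 0) (x y : F) {J K M N : ℕ} (hJ : J ≤ k + 1)
    (hK : K ≤ k + 1) (hM : M ≤ k) (hN : N ≤ k) :
    pemDirect t x y M N • infMul (pemMatrixX t k J M y) (pemMatrixX t k K N x) +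
      pemExchange t x y N M • infMul (pemMatrixX t k J N y) (pemMatrixX t k K M x) =
    pemDirect t x y J K • infMul (pemMatrixX t k J M x) (pemMatrixX t k K N y) +
      pemExchange t x y J K • infMul (pemMatrixX t k K M x) (pemMatrixX t k J N y) := by
  have hmul : ∀ {a b c d : ℕ} (z w : F), a ≤ k + 1 → b ≤ k → c ≤ k + 1 →
      infMul (pemMatrixX t k a b z) (pemMatrixX t k c d w) =
        (fugacity a z * fugacity c w) • infMul (pemMatrix t k a b) (pemMatrix t k c d) := by
    intro a b c d z w ha hb hc
    have := rowFinite_pemMatrix t ha hb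
    rw [pemMatrixX_eq, pemMatrixX_eq, smul_infMul _ _ this, infMul_smul _ _ this, smul_smul]
  rw [hmul _ _ hJ hM hK, hmul _ _ hJ hN hK, hmul _ _ hJ hM hK, hmul _ _ hK hM hJ]
  -- After reordering the unit vectors, all four products have the same support condition.
  ext r c
  simp only [Matrix.add_apply, Matrix.smul_apply, smul_eq_mul,
    infMul_pemMatrix_apply ht hJ hK hM hN, infMul_pemMatrix_apply ht hJ hK hN hM,
    infMul_pemMatrix_apply ht hK hJ hM hN, add_comm (unitAt k N) (unitAt k M),
    add_comm (unitAt k K) (unitAt k J)]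
  split_ifs
  · exact pemWeight_exchange ht x y _ _ (by simp [partialProd]) (by simp [siteValue]) J K M N
  · simp

end Exchange

/-! ### Exchange relations of the matrices `matX` -/

theorem rev_le (L J : ℕ) : rev L J ≤ L := by
  unfold rev
  split_ifs <;> omega

/-- Label `1` is the only one sent to `k + 2`, which is not a column label; this is why the
recursion omits it. -/
theorem rev_le_of_ne_one {k M : ℕ} (hM : M ≠ 1) : rev (k + 2) M ≤ k + 1 := by
  unfold rev
  split_ifs <;> omega

section MatX

variable {R : Type*} [CommRing R]

theorem rowFinite_matX (t : R) : ∀ (L J : ℕ) (x : R), RowFinite (matX t L J x)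
  | 0, _, _ => fun _ => Set.toFinite _
  | 1, _, _ => fun _ => Set.toFinite _
  | k + 2, J, x => by
    unfold matX
    refine RowFinite.sum _ fun M hM => RowFinite.kronecker ?_ (rowFinite_matX t (k + 1) _ x)
    rw [pemMatrixX_eq]
    exact (rowFinite_pemMatrix t (rev_le _ _)
      (rev_le_of_ne_one (Finset.ne_of_mem_erase hM))).smul _

theorem pemMatrix_map {R' : Type*} [CommRing R'] (φ : R →+* R') (t : R) {k J M : ℕ}
    (hJ : J ≤ k + 1) (hM : M ≤ k) : (pemMatrix t k J M).map φ = pemMatrix (φ t) k J M := by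
  ext r c
  rw [Matrix.map_apply, pemMatrix_apply t hJ hM, pemMatrix_apply (φ t) hJ hM]
  simp only [pemWeight, partialProd, siteValue]
  simp only [apply_ite φ, apply_dite φ, map_mul, map_prod, map_sub, map_one, map_zero, map_pow]

/-- Used twice: to pass to the fraction field, and to carry substitutions of the variables into the
products. -/
theorem matX_map {R' : Type*} [CommRing R'] (φ : R →+* R') (t : R) :
    ∀ (L J : ℕ) (x : R), (matX t L J x).map φ = matX (φ t) L J (φ x)
  | 0, _, _ => Matrix.map_zero _ (map_zero φ)
  | 1, _, _ => by
    ext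
    simp only [matX, Matrix.map_apply, Matrix.of_apply, apply_ite φ, map_one, map_zero]
  | k + 2, J, x => by
    ext ⟨r, r'⟩ ⟨c, c'⟩
    simp only [matX, Matrix.map_apply, Matrix.sum_apply, Matrix.kroneckerMap_apply, map_sum,
      map_mul]
    refine Finset.sum_congr rfl fun M hM => ?_
    have h1 : φ (matX t (k + 1) (M - 1) x r' c') = matX (φ t) (k + 1) (M - 1) (φ x) r' c' := by
      rw [← matX_map φ t (k + 1)]
      rfl
    have h2 : φ (pemMatrix t (k + 1) (rev (k + 2) J) (rev (k + 2) M) r c) =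
        pemMatrix (φ t) (k + 1) (rev (k + 2) J) (rev (k + 2) M) r c := by
      rw [← pemMatrix_map φ t (rev_le _ _) (rev_le_of_ne_one (Finset.ne_of_mem_erase hM))]
      rfl
    simp only [pemMatrixX_eq, Matrix.smul_apply, smul_eq_mul, map_mul, h1, h2, fugacity,
      apply_ite φ, map_one]

/-- The direct coefficient of the exchange relation, in the order in which class `L` is the
strongest. -/
def zfDirect (t x y : R) (a b : ℕ) : R :=
  if a = b then t * x - y else if b < a then -(y * (1 - t)) else -(x * (1 - t))

/-- The exchange coefficient of the exchange relation, in the order in which class `L` is the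
strongest. -/
def zfExchange (t x y : R) (a b : ℕ) : R :=
  if a = b then 0 else if b < a then x - y else t * (x - y)

/-- Reversal turns the strength order with `1` strongest into the usual order of numbers, with `0`
weakest in both. -/
theorem pemDirect_rev (t x y : R) {L a b : ℕ} (ha : a ≤ L) (hb : b ≤ L) :
    pemDirect t x y (rev L a) (rev L b) = zfDirect t x y a b := by
  unfold pemDirect zfDirect rev
  obtain h | h | h := lt_trichotomy a b <;>
  split_ifs <;> first | omega | rfl

theorem pemExchange_rev (t x y : R) {L a b : ℕ} (ha : a ≤ L) (hb : b ≤ L) :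
    pemExchange t x y (rev L a) (rev L b) = zfExchange t x y a b := by
  unfold pemExchange zfExchange rev
  obtain h | h | h := lt_trichotomy a b <;>
  split_ifs <;> first | omega | rfl

/-- On labels other than `1`, truncated `M - 1` is strictly increasing, and only the order type of
the labels enters. -/
theorem zfDirect_pred (t x y : R) {a b : ℕ} (ha : a ≠ 1) (hb : b ≠ 1) :
    zfDirect t x y (a - 1) (b - 1) = zfDirect t x y a b := by
  unfold zfDirect
  split_ifs <;> first | omega | rfl

theorem zfExchange_pred (t x y : R) {a b : ℕ} (ha : a ≠ 1) (hb : b ≠ 1) :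
    zfExchange t x y (a - 1) (b - 1) = zfExchange t x y a b := by
  unfold zfExchange
  split_ifs <;> first | omega | rfl

end MatX

theorem infMul_matX_succ {R : Type*} [CommRing R] (t : R) (k J K : ℕ) (x y : R) :
    infMul (matX t (k + 2) J x) (matX t (k + 2) K y) =
      ∑ M ∈ (Finset.range (k + 3)).erase 1, ∑ N ∈ (Finset.range (k + 3)).erase 1,
        infMul (pemMatrixX t (k + 1) (rev (k + 2) J) (rev (k + 2) M) x)
          (pemMatrixX t (k + 1) (rev (k + 2) K) (rev (k + 2) N) y) ⊗ₖ
        infMul (matX t (k + 1) (M - 1) x) (matX t (k + 1) (N - 1) y) := by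
  have h1 : ∀ M ∈ (Finset.range (k + 3)).erase 1,
      RowFinite (pemMatrixX t (k + 1) (rev (k + 2) J) (rev (k + 2) M) x) := fun M hM => by
    rw [pemMatrixX_eq]
    exact (rowFinite_pemMatrix t (rev_le _ _)
      (rev_le_of_ne_one (Finset.ne_of_mem_erase hM))).smul _
  have h2 := fun M hM => (h1 M hM).kronecker (rowFinite_matX t (k + 1) (M - 1) x)
  conv_lhs => unfold matX
  rw [sum_infMul _ _ h2]
  refine Finset.sum_congr rfl fun M hM => ?_
  rw [infMul_sum _ _ (h2 M hM)]
  exact Finset.sum_congr rfl fun N _ => infMul_kronecker (h1 M hM) (rowFinite_matX _ _ _ _)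

/-- The exchange relations of the matrices `X_J^{(L)}(x)` over a field. -/
theorem matX_exchange_field {F : Type*} [Field F] {t : F} (ht : t ≠ 0) (x y : F) :
    ∀ (L a b : ℕ), a ≤ L → b ≤ L →
      (t * x - y) • infMul (matX t L a y) (matX t L b x) =
        zfDirect t x y a b • infMul (matX t L a x) (matX t L b y) +
          zfExchange t x y a b • infMul (matX t L b x) (matX t L a y)
  | 0, _, _, _, _ => by
    ext i j
    simp only [infMul, matX, Matrix.smul_apply, Matrix.add_apply, Matrix.of_apply,
      Matrix.zero_apply, zero_mul, finsum_zero, smul_zero, add_zero]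
  | 1, a, b, ha, hb => by
    ext i j
    simp only [infMul, matX, Matrix.smul_apply, Matrix.add_apply, Matrix.of_apply, smul_eq_mul,
      finsum_eq_sum_of_fintype]
    have : Fintype.card (State 1) = 1 := rfl
    simp only [Finset.sum_const, Finset.card_univ, this, one_smul]
    interval_cases a <;> interval_cases b <;> 
      simp [zfDirect, zfExchange, -mul_eq_mul_left_iff, -mul_eq_mul_right_iff] <;> ring
  | k + 2, a, b, ha, hb => by
    rw [infMul_matX_succ t k a b y x, infMul_matX_succ t k a b x y, infMul_matX_succ t k b a x y]
    set s := (Finset.range (k + 3)).erase 1 with hs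
    let A : ℕ → ℕ → F → Matrix (Fin (k + 1) → ℕ) (Fin (k + 1) → ℕ) F := fun J M z =>
      pemMatrixX t (k + 1) (rev (k + 2) J) (rev (k + 2) M) z
    let X : ℕ → F → Matrix (State (k + 1)) (State (k + 1)) F := fun M z =>
      matX t (k + 1) (M - 1) z
    change (t * x - y) • ∑ M ∈ s, ∑ N ∈ s,
        infMul (A a M y) (A b N x) ⊗ₖ infMul (X M y) (X N x) =
      zfDirect t x y a b • (∑ M ∈ s, ∑ N ∈ s,
        infMul (A a M x) (A b N y) ⊗ₖ infMul (X M x) (X N y)) +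
      zfExchange t x y a b • (∑ M ∈ s, ∑ N ∈ s,
        infMul (A b M x) (A a N y) ⊗ₖ infMul (X M x) (X N y))
    have hmem : ∀ M ∈ s, M ≠ 1 ∧ M ≤ k + 2 := fun M hM => by
      rw [hs, Finset.mem_erase, Finset.mem_range] at hM
      omega
    have hX : ∀ M ∈ s, ∀ N ∈ s, (t * x - y) • infMul (X M y) (X N x) =
        zfDirect t x y M N • infMul (X M x) (X N y) +
          zfExchange t x y M N • infMul (X N x) (X M y) := by
      intro M hM N hN
      have h1 := hmem M hM
      have h2 := hmem N hN
      rw [← zfDirect_pred t x y h1.1 h2.1, ← zfExchange_pred t x y h1.1 h2.1]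
      exact matX_exchange_field ht x y (k + 1) (M - 1) (N - 1) (by omega) (by omega)
    have hA : ∀ M ∈ s, ∀ N ∈ s,
        zfDirect t x y M N • infMul (A a M y) (A b N x) +
          zfExchange t x y N M • infMul (A a N y) (A b M x) =
        zfDirect t x y a b • infMul (A a M x) (A b N y) +
          zfExchange t x y a b • infMul (A b M x) (A a N y) := by
      intro M hM N hN
      have h1 := hmem M hM
      have h2 := hmem N hN
      rw [← pemDirect_rev t x y h1.2 h2.2, ← pemExchange_rev t x y h2.2 h1.2,
        ← pemDirect_rev t x y ha hb, ← pemExchange_rev t x y ha hb]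
      exact pemMatrixX_exchange ht x y (rev_le _ _) (rev_le _ _) (rev_le_of_ne_one h1.1)
        (rev_le_of_ne_one h2.1)
    -- The induction hypothesis acts on the second tensor factors. Renaming `M` and `N` in the
    -- exchange terms makes $X_M(x)X_N(y)$ a common factor, and `hA` applies to its coefficient.
    calc (t * x - y) • ∑ M ∈ s, ∑ N ∈ s, infMul (A a M y) (A b N x) ⊗ₖ infMul (X M y) (X N x)
        = ∑ M ∈ s, ∑ N ∈ s,
            infMul (A a M y) (A b N x) ⊗ₖ ((t * x - y) • infMul (X M y) (X N x)) := by
          simp only [Finset.smul_sum, Matrix.kronecker_smul]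
      _ = ∑ M ∈ s, ∑ N ∈ s, infMul (A a M y) (A b N x) ⊗ₖ
            (zfDirect t x y M N • infMul (X M x) (X N y) +
              zfExchange t x y M N • infMul (X N x) (X M y)) :=
          Finset.sum_congr rfl fun M hM => Finset.sum_congr rfl fun N hN => by rw [hX M hM N hN]
      _ = ∑ M ∈ s, ∑ N ∈ s, (zfDirect t x y M N • infMul (A a M y) (A b N x)) ⊗ₖ
              infMul (X M x) (X N y) +
          ∑ N ∈ s, ∑ M ∈ s, (zfExchange t x y N M • infMul (A a N y) (A b M x)) ⊗ₖ
              infMul (X M x) (X N y) := by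
          simp only [Matrix.kronecker_add, Matrix.kronecker_smul, Matrix.smul_kronecker,
            Finset.sum_add_distrib]
      _ = ∑ M ∈ s, ∑ N ∈ s, (zfDirect t x y M N • infMul (A a M y) (A b N x) +
            zfExchange t x y N M • infMul (A a N y) (A b M x)) ⊗ₖ
              infMul (X M x) (X N y) := by
          rw [Finset.sum_comm (f := fun N M => (zfExchange t x y N M •
            infMul (A a N y) (A b M x)) ⊗ₖ infMul (X M x) (X N y))]
          simp only [Matrix.add_kronecker, Finset.sum_add_distrib]
      _ = ∑ M ∈ s, ∑ N ∈ s, (zfDirect t x y a b • infMul (A a M x) (A b N y) +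
            zfExchange t x y a b • infMul (A b M x) (A a N y)) ⊗ₖ
              infMul (X M x) (X N y) :=
          Finset.sum_congr rfl fun M hM => Finset.sum_congr rfl fun N hN => by rw [hA M hM N hN]
      _ = _ := by
          simp only [Matrix.add_kronecker, Matrix.smul_kronecker, Finset.sum_add_distrib,
            Finset.smul_sum]

/-- The exchange relations of the matrices `X_J^{(L)}(x)` over a domain. -/
theorem matX_exchange {R : Type*} [CommRing R] [IsDomain R] {t : R} (ht : t ≠ 0) (x y : R)
    {L a b : ℕ} (ha : a ≤ L) (hb : b ≤ L) :
    (t * x - y) • infMul (matX t L a y) (matX t L b x) =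
      zfDirect t x y a b • infMul (matX t L a x) (matX t L b y) +
        zfExchange t x y a b • infMul (matX t L b x) (matX t L a y) := by
  -- The weight identity divides by `t`, hence the detour through the fraction field.
  let φ := algebraMap R (FractionRing R)
  have hφ : Function.Injective φ := IsFractionRing.injective R (FractionRing R)
  have hmap : ∀ (c d : ℕ) (z w : R) (i j : State L),
      φ (infMul (matX t L c z) (matX t L d w) i j) =
        infMul (matX (φ t) L c (φ z)) (matX (φ t) L d (φ w)) i j := by
    intro c d z w i j
    rw [← matX_map, ← matX_map, ← infMul_map φ _ (rowFinite_matX _ _ _ _), Matrix.map_apply]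
  have hD : φ (zfDirect t x y a b) = zfDirect (φ t) (φ x) (φ y) a b := by
    simp only [zfDirect, apply_ite φ, map_neg, map_mul, map_sub, map_one]
  have hE : φ (zfExchange t x y a b) = zfExchange (φ t) (φ x) (φ y) a b := by
    simp only [zfExchange, apply_ite φ, map_zero, map_mul, map_sub]
  ext i j
  apply hφ
  have := congrFun (congrFun (matX_exchange_field
    ((map_ne_zero_iff φ hφ).mpr ht) (φ x) (φ y) L a b ha hb) i) j
  simpa only [Matrix.add_apply, Matrix.smul_apply, smul_eq_mul, map_add, map_mul, hmap, hD, hE,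
    map_sub] using this

/-! ### Conjugation by the twist -/

section Twist

variable {R : Type*} [CommRing R]

/-- The exponent of `q` in the diagonal entries of the twist. -/
def twistDegree : (L : ℕ) → State L → ℕ
  | 0, _ => 0
  | 1, _ => 0
  | k + 2, s => (∑ p : Fin (k + 1), (k + 1 - p.val) * s.1 p) + twistDegree (k + 1) s.2

/-- Every occupation number enters the degree with a coefficient at least `1`, so it is bounded by
`d`. -/
theorem finite_twistDegree_le : ∀ (L d : ℕ), {s : State L | twistDegree L s ≤ d}.Finite
  | 0, _ => Set.toFinite (α := Unit) _
  | 1, _ => Set.toFinite (α := Unit) _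
  | k + 2, d => by
    refine ((Set.finite_Iic (fun _ : Fin (k + 1) => d)).prod
      (finite_twistDegree_le (k + 1) d)).subset ?_
    rintro ⟨r, s⟩ h
    simp only [twistDegree, Set.mem_ofPred_eq] at h
    refine ⟨fun p => ?_, by simp only [Set.mem_ofPred_eq]; omega⟩
    have h1 : (k + 1 - p.val) * r p ≤ ∑ p : Fin (k + 1), (k + 1 - p.val) * r p :=
      Finset.single_le_sum (f := fun p : Fin (k + 1) => (k + 1 - p.val) * r p)
        (fun _ _ => Nat.zero_le _) (Finset.mem_univ p)
    have h2 : 1 * r p ≤ (k + 1 - p.val) * r p := Nat.mul_le_mul_right _ (by omega)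
    simp only
    omega

open Classical in
theorem matS_apply (q : R) : ∀ {L : ℕ} (_ : 1 ≤ L) (s s' : State L),
    matS q L s s' = if s = s' then q ^ twistDegree L s else 0
  | 1, _, _, _ => by
    rw [if_pos (Subsingleton.elim (α := Unit) _ _), twistDegree, pow_zero]
    rfl
  | k + 2, _, ⟨r, s⟩, ⟨r', s'⟩ => by
    simp only [matS, Matrix.kroneckerMap_apply, matS_apply q (Nat.le_add_left 1 k), tensor, matD,
      Matrix.of_apply, twistDegree, Prod.mk.injEq]
    by_cases h : r = r'
    · subst h
      by_cases h' : s = s'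
      · simp [h', pow_add, ← pow_mul, Finset.prod_pow_eq_pow_sum]
      · simp [h']
    · obtain ⟨p, hp⟩ := Function.ne_iff.mp h
      rw [Finset.prod_eq_zero (Finset.mem_univ p) (if_neg hp), zero_mul, if_neg fun h' => h h'.1]

theorem sum_mul_unitAt {k M : ℕ} (hM : M ≤ k) :
    ∑ p : Fin k, (k - p.val) * unitAt k M p = if M = 0 then 0 else k + 1 - M := by
  unfold unitAt
  split_ifs with h
  · exact Finset.sum_eq_zero fun p _ => by simp [h]
  · rw [Finset.sum_eq_single ⟨M - 1, by omega⟩]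
    · rw [if_pos (by simp only; omega)]
      simp only
      omega
    · intro p _ hp
      rw [if_neg (show ¬p.val + 1 = M from fun h' => hp (Fin.ext (by simp only; omega))),
        mul_zero]
    · simp

theorem unitAt_succ_self (k : ℕ) : unitAt k (k + 1) = 0 := by
  funext p
  have := p.isLt
  exact if_neg (by omega)

/-- The exponents in the twist are chosen so that class `J`, sitting in position $J^*$, counts `J -
1`. Classes `0` and `1` occupy no position and count `0`, in agreement with truncated subtraction.
-/
theorem sum_mul_unitAt_rev {k J : ℕ} (hJ : J ≤ k + 2) :
    ∑ p : Fin (k + 1), (k + 1 - p.val) * unitAt (k + 1) (rev (k + 2) J) p = J - 1 := by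
  by_cases h1 : J = 1
  · subst h1
    rw [show rev (k + 2) 1 = k + 1 + 1 from rfl, unitAt_succ_self]
    simp
  · rw [sum_mul_unitAt (rev_le_of_ne_one h1)]
    unfold rev
    split_ifs <;> omega

/-- Conjugation with the twist multiplies the spectral parameter by `q`. -/
theorem twist_matX (t q : R) : ∀ {L J : ℕ} (_ : 1 ≤ L) (_ : J ≤ L) (x : R) (s s' : State L),
    q ^ twistDegree L s * matX t L J (q * x) s s' =
      q ^ J * matX t L J x s s' * q ^ twistDegree L s'
  | 1, J, _, hJ, x, s, s' => by
    simp only [twistDegree, matX, Matrix.of_apply]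
    interval_cases J <;> simp
  | k + 2, J, _, hJ, x, ⟨r, s⟩, ⟨r', s'⟩ => by
    simp only [matX, Matrix.sum_apply, Matrix.kroneckerMap_apply, Finset.mul_sum, Finset.sum_mul]
    refine Finset.sum_congr rfl fun M hM => ?_
    rw [Finset.mem_erase, Finset.mem_range] at hM
    have ih := twist_matX t q (L := k + 1) (J := M - 1) (by omega) (by omega) x s s'
    simp only [pemMatrixX_eq, Matrix.smul_apply, smul_eq_mul,
      pemMatrix_apply t (rev_le _ _) (rev_le_of_ne_one hM.1)]
    split_ifs with h
    · have hdeg : ∑ p : Fin (k + 1), (k + 1 - p.val) * r p + (M - 1) =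
          ∑ p : Fin (k + 1), (k + 1 - p.val) * r' p + (J - 1) := by
        rw [← sum_mul_unitAt_rev hJ, ← sum_mul_unitAt_rev (show M ≤ k + 2 by omega),
          ← Finset.sum_add_distrib, ← Finset.sum_add_distrib]
        refine Finset.sum_congr rfl fun p _ => ?_
        rw [← mul_add, ← mul_add]
        exact congrArg _ (congrFun h p)
      -- For `J > 0` the fugacity supplies the one power of `q` missing from `J - 1`.
      have hfug : fugacity (rev (k + 2) J) (q * x) * q ^ (J - 1) =
          q ^ J * fugacity (rev (k + 2) J) x := by
        unfold fugacity
        obtain rfl | hJ0 := Nat.eq_zero_or_pos J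
        · simp [rev]
        · have hr : 0 < rev (k + 2) J := by
            unfold rev
            split_ifs <;> omega
          rw [if_pos hr, if_pos hr]
          obtain ⟨j, rfl⟩ : ∃ j, J = j + 1 := ⟨J - 1, by omega⟩
          rw [Nat.add_sub_cancel]
          ring
      simp only [twistDegree, pow_add]
      generalize pemWeight (R := R) _ _ _ _ = w
      calc _ = fugacity (rev (k + 2) J) (q * x) * w *
              q ^ (∑ p : Fin (k + 1), (k + 1 - p.val) * r p) *
              (q ^ twistDegree (k + 1) s * matX t (k + 1) (M - 1) (q * x) s s') := by ring
        _ = fugacity (rev (k + 2) J) (q * x) * w *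
              q ^ (∑ p : Fin (k + 1), (k + 1 - p.val) * r p + (M - 1)) *
              (matX t (k + 1) (M - 1) x s s' * q ^ twistDegree (k + 1) s') := by
            rw [ih]; ring
        _ = (fugacity (rev (k + 2) J) (q * x) * q ^ (J - 1)) * w *
              q ^ (∑ p : Fin (k + 1), (k + 1 - p.val) * r' p) *
              (matX t (k + 1) (M - 1) x s s' * q ^ twistDegree (k + 1) s') := by
            rw [hdeg]; ring
        _ = _ := by rw [hfug]; ring
    · ring

end Twist

/-! ### Traces as `q`-adic limits -/

section Trace

variable {n : ℕ} {σ : Type*}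

theorem qq_pow_dvd_iff (D : ℕ) (f : PolyRing n) :
    qq n ^ D ∣ f ↔ ∀ m, ∀ d < D, PowerSeries.coeff d (MvPolynomial.coeff m f) = 0 := by
  rw [qq, ← map_pow, MvPolynomial.C_dvd_iff_dvd_coeff]
  exact forall_congr' fun m => PowerSeries.X_pow_dvd_iff

/-- The ring is `q`-adically separated, so identities between limits may be checked modulo each
power of `q`. -/
theorem eq_of_forall_qq_pow_dvd {f g : PolyRing n} (h : ∀ D, qq n ^ (D + 1) ∣ f - g) : f = g := by
  rw [← sub_eq_zero]
  refine MvPolynomial.ext _ _ fun m => PowerSeries.ext fun d => ?_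
  rw [MvPolynomial.coeff_zero, map_zero]
  exact (qq_pow_dvd_iff _ _).mp (h d) m d (Nat.lt_succ_self d)

/-- `IsTwistedSum w g f` says that `f` is the `q`-adic limit of the sums of `q ^ w s * g s`. -/
def IsTwistedSum (w : σ → ℕ) (g : σ → PolyRing n) (f : PolyRing n) : Prop :=
  ∀ (D : ℕ) (S : Finset σ), (∀ s, s ∈ S ↔ w s ≤ D) →
    qq n ^ (D + 1) ∣ f - ∑ s ∈ S, qq n ^ w s * g s

theorem exists_finset_le {w : σ → ℕ} (hw : ∀ d, {s | w s ≤ d}.Finite) (D : ℕ) :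
    ∃ S : Finset σ, ∀ s, s ∈ S ↔ w s ≤ D :=
  ⟨(hw D).toFinset, fun s => by simp⟩

theorem coeff_qq_pow_mul (e d : ℕ) (m : Fin n →₀ ℕ) (g : PolyRing n) :
    PowerSeries.coeff d (MvPolynomial.coeff m (qq n ^ e * g)) =
      if e ≤ d then PowerSeries.coeff (d - e) (MvPolynomial.coeff m g) else 0 := by
  rw [qq, ← map_pow, MvPolynomial.coeff_C_mul, PowerSeries.coeff_X_pow_mul']

theorem IsTwistedSum.hasFormalTrace {w : σ → ℕ} (hw : ∀ d, {s | w s ≤ d}.Finite)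
    {g : σ → PolyRing n} {f : PolyRing n} (h : IsTwistedSum w g f)
    {M : Matrix σ σ (PolyRing n)} (hM : ∀ s, M s s = qq n ^ w s * g s) : HasFormalTrace M f := by
  intro m d
  obtain ⟨S, hS⟩ := exists_finset_le hw d
  have hsub : {s : σ | PowerSeries.coeff d (MvPolynomial.coeff m (M s s)) ≠ 0} ⊆ S := by
    intro s hs
    rw [Finset.mem_coe, hS]
    by_contra hlt
    apply hs
    rw [hM, coeff_qq_pow_mul, if_neg hlt]
  refine ⟨S.finite_toSet.subset hsub, ?_⟩
  rw [finsum_eq_sum_of_support_subset _ hsub]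
  have h0 := (qq_pow_dvd_iff _ _).mp (h d S hS) m d (Nat.lt_succ_self d)
  rw [MvPolynomial.coeff_sub, map_sub, MvPolynomial.coeff_sum, map_sum, sub_eq_zero] at h0
  rw [h0]
  exact Finset.sum_congr rfl fun s _ => by rw [hM]

theorem HasFormalTrace.unique {M : Matrix σ σ (PolyRing n)} {f f' : PolyRing n}
    (h : HasFormalTrace M f) (h' : HasFormalTrace M f') : f = f' :=
  MvPolynomial.ext _ _ fun m => PowerSeries.ext fun d => (h m d).2.trans (h' m d).2.symm

theorem HasFormalTrace.formalTrace_eq {M : Matrix σ σ (PolyRing n)} {f : PolyRing n}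
    (h : HasFormalTrace M f) : formalTrace M = f := by
  have hex : ∃ f, HasFormalTrace M f := ⟨f, h⟩
  rw [formalTrace, dif_pos hex]
  exact hex.choose_spec.unique h

/-- Each coefficient of $x^mq^d$ is a finite sum. The degree bound, uniform in the state, confines
the exponents `m` to a finite box, which makes the limit a polynomial in the variables. -/
theorem exists_isTwistedSum {w : σ → ℕ} (hw : ∀ d, {s | w s ≤ d}.Finite) (g : σ → PolyRing n)
    (B : ℕ) (hg : ∀ s, (g s).totalDegree ≤ B) : ∃ f, IsTwistedSum w g f := by
  classical
  choose S hS using exists_finset_le hw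
  let T : Finset (Fin n →₀ ℕ) := Finset.Iic (Finsupp.equivFunOnFinite.symm fun _ => B)
  have hT : ∀ s, ∀ m ∉ T, MvPolynomial.coeff m (g s) = 0 := by
    intro s m hm
    by_contra hne
    apply hm
    rw [Finset.mem_Iic]
    intro i
    exact (MvPolynomial.monomial_le_degreeOf i (MvPolynomial.mem_support_iff.mpr hne)).trans
      ((MvPolynomial.degreeOf_le_totalDegree _ _).trans (hg s))
  refine ⟨∑ m ∈ T, MvPolynomial.monomial m (PowerSeries.mk fun d =>
    ∑ s ∈ S d, PowerSeries.coeff d (MvPolynomial.coeff m (qq n ^ w s * g s))), ?_⟩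
  intro D S' hS'
  rw [qq_pow_dvd_iff]
  intro m d hd
  rw [MvPolynomial.coeff_sub, map_sub, sub_eq_zero, MvPolynomial.coeff_sum,
    MvPolynomial.coeff_sum]
  have hsum : ∑ s ∈ S', PowerSeries.coeff d (MvPolynomial.coeff m (qq n ^ w s * g s)) =
      ∑ s ∈ S d, PowerSeries.coeff d (MvPolynomial.coeff m (qq n ^ w s * g s)) := by
    refine (Finset.sum_subset (fun s hs => ?_) fun s _ hs => ?_).symm
    · rw [hS] at hs
      rw [hS']
      omega
    · rw [hS] at hs
      rw [coeff_qq_pow_mul, if_neg hs]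
  rw [map_sum (PowerSeries.coeff d) _ S', hsum]
  simp only [MvPolynomial.coeff_monomial, Finset.sum_ite_eq']
  split_ifs with hm
  · rw [PowerSeries.coeff_mk]
  · rw [map_zero]
    refine (Finset.sum_eq_zero fun s _ => ?_).symm
    rw [coeff_qq_pow_mul, hT s m hm, map_zero, ite_self]

theorem IsTwistedSum.map {w : σ → ℕ} {g : σ → PolyRing n} {f : PolyRing n}
    (h : IsTwistedSum w g f) (φ : PolyRing n →+* PolyRing n) (hφ : φ (qq n) = qq n) :
    IsTwistedSum w (fun s => φ (g s)) (φ f) := by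
  intro D S hS
  have := map_dvd φ (h D S hS)
  simpa only [map_pow, hφ, map_sub, map_sum, map_mul] using this

theorem IsTwistedSum.linear_relation {w : σ → ℕ} (hw : ∀ d, {s | w s ≤ d}.Finite)
    {g₁ g₂ g₃ : σ → PolyRing n} {f₁ f₂ f₃ : PolyRing n} (h₁ : IsTwistedSum w g₁ f₁)
    (h₂ : IsTwistedSum w g₂ f₂) (h₃ : IsTwistedSum w g₃ f₃) (a b c : PolyRing n)
    (h : ∀ s, a * g₁ s = b * g₂ s + c * g₃ s) : a * f₁ = b * f₂ + c * f₃ := by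
  refine eq_of_forall_qq_pow_dvd fun D => ?_
  obtain ⟨S, hS⟩ := exists_finset_le hw D
  have hsum : a * ∑ s ∈ S, qq n ^ w s * g₁ s =
      b * ∑ s ∈ S, qq n ^ w s * g₂ s + c * ∑ s ∈ S, qq n ^ w s * g₃ s := by
    rw [Finset.mul_sum, Finset.mul_sum, Finset.mul_sum, ← Finset.sum_add_distrib]
    refine Finset.sum_congr rfl fun s _ => ?_
    linear_combination qq n ^ w s * h s
  have := ((h₁ D S hS).mul_left a).sub (((h₂ D S hS).mul_left b).add ((h₃ D S hS).mul_left c))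
  convert this using 1
  linear_combination hsum

theorem dvd_mul_infMul_sub_sum {A B : Matrix σ σ (PolyRing n)} (hA : RowFinite A) (i j : σ)
    (c N : PolyRing n) (S : Finset σ) (h : ∀ k ∉ S, N ∣ c * (A i k * B k j)) :
    N ∣ c * infMul A B i j - ∑ k ∈ S, c * (A i k * B k j) := by
  classical
  obtain ⟨T, hT⟩ := hA.exists_finset i
  rw [infMul_apply_eq_sum (S ∪ T) (hT.trans (by simp)), Finset.mul_sum,
    ← Finset.sum_sdiff (Finset.subset_union_left (s₁ := S) (s₂ := T)), add_sub_cancel_right]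
  exact Finset.dvd_sum fun k hk => h k (Finset.mem_sdiff.mp hk).2

/-- Cyclicity of the trace, for a factor that commutes with the twist up to a scalar. -/
theorem IsTwistedSum.cyclic {w : σ → ℕ} (hw : ∀ d, {s | w s ≤ d}.Finite) {e : ℕ}
    {A B B' : Matrix σ σ (PolyRing n)} (hA : RowFinite A) (hB : RowFinite B)
    (hBB' : ∀ s k, qq n ^ w s * B s k = qq n ^ e * B' s k * qq n ^ w k) {f f' : PolyRing n}
    (hf : IsTwistedSum w (fun s => infMul A B' s s) f)
    (hf' : IsTwistedSum w (fun s => infMul B A s s) f') : qq n ^ e * f = f' := by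
  refine eq_of_forall_qq_pow_dvd fun D => ?_
  obtain ⟨S, hS⟩ := exists_finset_le hw D
  have hpow : ∀ s ∉ S, qq n ^ (D + 1) ∣ qq n ^ w s := fun s hs => by
    rw [hS] at hs
    exact pow_dvd_pow _ (by omega)
  -- Moving the twist past `B` produces `qq n ^ w k`, so intermediate states outside `S` are
  -- negligible too. Here and in `h2` both traces are cut down to sums over `S` × `S`, which `hswap`
  -- identifies.
  have h1 : qq n ^ (D + 1) ∣ ∑ s ∈ S, (qq n ^ w s * infMul B A s s -
      ∑ k ∈ S, qq n ^ w s * (B s k * A k s)) := by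
    refine Finset.dvd_sum fun s _ => dvd_mul_infMul_sub_sum hB _ _ _ _ _ fun k hk => ?_
    rw [← mul_assoc, hBB', mul_assoc, mul_comm (qq n ^ w k), ← mul_assoc]
    exact (hpow k hk).mul_left _
  have h2 : qq n ^ (D + 1) ∣ ∑ k ∈ S, (qq n ^ e * qq n ^ w k * infMul A B' k k -
      ∑ s ∈ S, qq n ^ e * qq n ^ w k * (A k s * B' s k)) := by
    refine Finset.dvd_sum fun k _ => dvd_mul_infMul_sub_sum hA _ _ _ _ _ fun s hs => ?_
    rw [show qq n ^ e * qq n ^ w k * (A k s * B' s k) = qq n ^ w s * (B s k * A k s) by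
      linear_combination -(A k s) * hBB' s k]
    exact (hpow s hs).mul_right _
  have hswap : ∑ k ∈ S, ∑ s ∈ S, qq n ^ e * qq n ^ w k * (A k s * B' s k) =
      ∑ s ∈ S, ∑ k ∈ S, qq n ^ w s * (B s k * A k s) := by
    rw [Finset.sum_comm]
    refine Finset.sum_congr rfl fun s _ => Finset.sum_congr rfl fun k _ => ?_
    linear_combination -(A k s) * hBB' s k
  have hfac : ∑ k ∈ S, qq n ^ e * qq n ^ w k * infMul A B' k k =
      qq n ^ e * ∑ k ∈ S, qq n ^ w k * infMul A B' k k := by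
    rw [Finset.mul_sum]
    exact Finset.sum_congr rfl fun k _ => mul_assoc _ _ _
  rw [Finset.sum_sub_distrib] at h1 h2
  rw [hswap, hfac] at h2
  have := (((hf D S hS).mul_left (qq n ^ e)).sub (hf' D S hS)).add (h2.sub h1)
  convert this using 1
  ring

end Trace

/-! ### Uniform degree bounds -/

section Degree

variable {n : ℕ} {S : Type*} [CommRing S] {σ : Type*}

theorem totalDegree_infMul_le {A B : Matrix σ σ (MvPolynomial (Fin n) S)} (hA : RowFinite A)
    {a b : ℕ} (ha : ∀ i j, (A i j).totalDegree ≤ a) (hb : ∀ i j, (B i j).totalDegree ≤ b)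
    (i j : σ) : (infMul A B i j).totalDegree ≤ a + b := by
  obtain ⟨T, hT⟩ := hA.exists_finset i
  rw [infMul_apply_eq_sum T hT]
  exact MvPolynomial.totalDegree_finsetSum_le fun k _ =>
    (MvPolynomial.totalDegree_mul _ _).trans (add_le_add (ha i k) (hb k j))

theorem totalDegree_infProd_le {k a : ℕ} {M : Fin k → Matrix σ σ (MvPolynomial (Fin n) S)}
    (hM : ∀ p, RowFinite (M p)) (ha : ∀ p i j, (M p i j).totalDegree ≤ a) (i j : σ) :
    (infProd M i j).totalDegree ≤ k * a := by
  classical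
  induction k generalizing i j with
  | zero =>
    rw [infProd_zero, Matrix.one_apply]
    split_ifs <;> simp
  | succ k ih =>
    rw [infProd_succ]
    refine (totalDegree_infMul_le (hM 0) (ha 0) (ih (fun p => hM _) fun p => ha _) i j).trans ?_
    rw [add_mul, one_mul, add_comm]

theorem totalDegree_pemMatrix (t : S) {k J M : ℕ} (hJ : J ≤ k + 1) (hM : M ≤ k)
    (r c : Fin k → ℕ) :
    (pemMatrix (MvPolynomial.C t : MvPolynomial (Fin n) S) k J M r c).totalDegree = 0 := by
  rw [← pemMatrix_map (MvPolynomial.C : S →+* MvPolynomial (Fin n) S) t hJ hM, Matrix.map_apply,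
    MvPolynomial.totalDegree_C]

theorem totalDegree_fugacity_le (J : ℕ) {x : MvPolynomial (Fin n) S} (hx : x.totalDegree ≤ 1) :
    (fugacity J x).totalDegree ≤ 1 := by
  unfold fugacity
  split_ifs
  · exact hx
  · simp

/-- Each level of the recursion contributes at most one factor `x`, whatever the states. -/
theorem totalDegree_matX_le (t : S) {x : MvPolynomial (Fin n) S} (hx : x.totalDegree ≤ 1) :
    ∀ (L J : ℕ) (s s' : State L), (matX (MvPolynomial.C t) L J x s s').totalDegree ≤ L
  | 0, _, _, _ => by simp [matX]
  | 1, J, _, _ => by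
    simp only [matX, Matrix.of_apply]
    split_ifs
    · simp
    · exact hx
    · simp
  | k + 2, J, ⟨r, s⟩, ⟨r', s'⟩ => by
    simp only [matX, Matrix.sum_apply, Matrix.kroneckerMap_apply]
    refine MvPolynomial.totalDegree_finsetSum_le fun M hM => ?_
    rw [pemMatrixX_eq, Matrix.smul_apply, smul_eq_mul]
    have h1 := MvPolynomial.totalDegree_mul (fugacity (rev (k + 2) J) x *
      pemMatrix (MvPolynomial.C t) (k + 1) (rev (k + 2) J) (rev (k + 2) M) r r')
      (matX (MvPolynomial.C t) (k + 1) (M - 1) x s s')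
    have h2 := MvPolynomial.totalDegree_mul (fugacity (rev (k + 2) J) x)
      (pemMatrix (MvPolynomial.C t) (k + 1) (rev (k + 2) J) (rev (k + 2) M) r r')
    have h3 := totalDegree_pemMatrix (n := n) t (rev_le (k + 2) J)
      (rev_le_of_ne_one (Finset.ne_of_mem_erase hM)) r r'
    have h4 := totalDegree_fugacity_le (rev (k + 2) J) hx
    have h5 := totalDegree_matX_le t hx (k + 1) (M - 1) s s'
    omega

end Degree

/-! ### Relations of the traces -/

section Main

/-- The matrix `X_{μ_1}(x_1) ⋯ X_{μ_n}(x_n)` without the twist. -/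
def matProd {n : ℕ} (L : ℕ) (μ : Fin n → ℕ) (x : Fin n → PolyRing n) :
    Matrix (State L) (State L) (PolyRing n) :=
  infProd fun i => matX (tt n) L (μ i) (x i)

theorem ansatzProduct_diag {n L : ℕ} (hL : 1 ≤ L) (μ : Fin n → ℕ) (s : State L) :
    ansatzProduct L μ s s =
      qq n ^ twistDegree L s * matProd L μ (fun i => MvPolynomial.X i) s s := by
  change ∑ᶠ k, matProd L μ (fun i => MvPolynomial.X i) s k * matS (qq n) L k s = _
  rw [finsum_eq_single _ s]
  · rw [matS_apply _ hL, if_pos rfl, mul_comm]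
  · intro k hk
    rw [matS_apply _ hL, if_neg hk, mul_zero]

theorem exists_isTwistedSum_matProd {n : ℕ} (L : ℕ) (μ : Fin n → ℕ) :
    ∃ f, IsTwistedSum (twistDegree L)
      (fun s => matProd L μ (fun i => MvPolynomial.X i) s s) f := by
  refine exists_isTwistedSum (finite_twistDegree_le L) _ (n * L) fun s => ?_
  refine totalDegree_infProd_le (fun p => rowFinite_matX _ _ _ _) (fun p i j => ?_) s s
  exact totalDegree_matX_le _ (MvPolynomial.totalDegree_X _).le _ _ _ _

theorem isTwistedSum_traceY {n L : ℕ} (hL : 1 ≤ L) (μ : Fin n → ℕ) :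
    IsTwistedSum (twistDegree L) (fun s => matProd L μ (fun i => MvPolynomial.X i) s s)
      (traceY L μ) := by
  obtain ⟨f, hf⟩ := exists_isTwistedSum_matProd L μ
  have := hf.hasFormalTrace (finite_twistDegree_le L) (ansatzProduct_diag hL μ)
  rwa [traceY, this.formalTrace_eq]

theorem matProd_map {n L : ℕ} (φ : PolyRing n →+* PolyRing n) (hφ : φ (tt n) = tt n)
    (μ : Fin n → ℕ) (x : Fin n → PolyRing n) (s s' : State L) :
    φ (matProd L μ x s s') = matProd L μ (fun i => φ (x i)) s s' := by
  have := infProd_map φ (M := fun i => matX (tt n) L (μ i) (x i))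
    fun i => rowFinite_matX _ _ _ _
  simp only [matX_map, hφ] at this
  exact congrFun (congrFun this s) s'

theorem tt_ne_zero (n : ℕ) : tt n ≠ 0 := by
  unfold tt
  rw [Ne, MvPolynomial.C_eq_zero]
  intro h
  exact Polynomial.X_ne_zero (PowerSeries.C_injective (h.trans (map_zero _).symm))

/-- The exchange relation of the traces. -/
theorem traceY_exchange {m L : ℕ} (hL : 1 ≤ L) (μ : Fin (m + 1) → ℕ) (hμ : ∀ k, μ k ≤ L)
    (i : Fin m) :
    (tt (m + 1) * MvPolynomial.X i.castSucc - MvPolynomial.X i.succ) *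
        MvPolynomial.rename (Equiv.swap i.castSucc i.succ) (traceY L μ) =
      zfDirect (tt (m + 1)) (MvPolynomial.X i.castSucc) (MvPolynomial.X i.succ)
          (μ i.castSucc) (μ i.succ) * traceY L μ +
        zfExchange (tt (m + 1)) (MvPolynomial.X i.castSucc) (MvPolynomial.X i.succ)
          (μ i.castSucc) (μ i.succ) * traceY L (μ ∘ Equiv.swap i.castSucc i.succ) := by
  set e := Equiv.swap i.castSucc i.succ with he
  let φ : PolyRing (m + 1) →+* PolyRing (m + 1) := (MvPolynomial.rename e).toRingHom
  have hq : φ (qq (m + 1)) = qq (m + 1) := MvPolynomial.rename_C _ _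
  have ht : φ (tt (m + 1)) = tt (m + 1) := MvPolynomial.rename_C _ _
  have hX : ∀ k, φ (MvPolynomial.X k) = MvPolynomial.X (e k) := MvPolynomial.rename_X _
  -- Applying $s_i$ to the trace exchanges the two spectral parameters and leaves the labels in
  -- place: this is the left side of the matrix exchange relation.
  have h1 := (isTwistedSum_traceY hL μ).map φ hq
  simp only [matProd_map φ ht, hX] at h1
  refine h1.linear_relation (finite_twistDegree_le L) (isTwistedSum_traceY hL μ)
    (isTwistedSum_traceY hL (μ ∘ e)) _ _ _ fun s => ?_
  have hcs : e i.castSucc = i.succ := Equiv.swap_apply_left _ _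
  have hsc : e i.succ = i.castSucc := Equiv.swap_apply_right _ _
  have hne : ∀ k, k ≠ i.castSucc → k ≠ i.succ → e k = k := fun k h h' =>
    Equiv.swap_apply_of_ne_of_ne h h'
  have hex := matX_exchange (tt_ne_zero (m + 1)) (MvPolynomial.X i.castSucc)
    (MvPolynomial.X i.succ) (hμ i.castSucc) (hμ i.succ)
  have key := infProd_exchange i
    (tt (m + 1) * MvPolynomial.X i.castSucc - MvPolynomial.X i.succ)
    (zfDirect (tt (m + 1)) (MvPolynomial.X i.castSucc) (MvPolynomial.X i.succ)
          (μ i.castSucc) (μ i.succ))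
    (zfExchange (tt (m + 1)) (MvPolynomial.X i.castSucc) (MvPolynomial.X i.succ)
          (μ i.castSucc) (μ i.succ))
    (M := fun k => matX (tt (m + 1)) L (μ k) (MvPolynomial.X (e k)))
    (N := fun k => matX (tt (m + 1)) L (μ k) (MvPolynomial.X k))
    (P := fun k => matX (tt (m + 1)) L ((μ ∘ e) k) (MvPolynomial.X k))
    (fun k => rowFinite_matX _ _ _ _) (fun k => rowFinite_matX _ _ _ _)
    (fun k => rowFinite_matX _ _ _ _)
    (fun k h h' => by rw [hne k h h'])
    (fun k h h' => by rw [Function.comp_apply, hne k h h'])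
    (by simpa only [Function.comp_apply, hcs, hsc] using hex)
  exact congrFun (congrFun key s) s

/-- The cyclic relation of the traces. -/
theorem traceY_rotate {m L : ℕ} (hL : 1 ≤ L) (μ : Fin (m + 1) → ℕ) (hμ : ∀ k, μ k ≤ L) :
    qq (m + 1) ^ μ (Fin.last m) * traceY L μ = shift (traceY L (rotate μ)) := by
  let x : Fin (m + 1) → PolyRing (m + 1) :=
    Fin.cons (qq (m + 1) * MvPolynomial.X (Fin.last m)) fun k : Fin m => MvPolynomial.X k.castSucc
  let φ : PolyRing (m + 1) →+* PolyRing (m + 1) := (MvPolynomial.aeval x).toRingHom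
  have hq : φ (qq (m + 1)) = qq (m + 1) := MvPolynomial.aeval_C _ _
  have ht : φ (tt (m + 1)) = tt (m + 1) := MvPolynomial.aeval_C _ _
  have hX : ∀ k, φ (MvPolynomial.X k) = x k := MvPolynomial.aeval_X _
  -- The substitution gives the first factor, with label $\mu_n$, the parameter $qx_n$; the twist
  -- relation then lets it move cyclically to the end.
  have h1 := (isTwistedSum_traceY hL (rotate μ)).map φ hq
  simp only [matProd_map φ ht, hX] at h1
  have h2 := isTwistedSum_traceY hL μ
  have hP : ∀ y : Fin (m + 1) → PolyRing (m + 1), matProd L μ y =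
      infMul (infProd fun k : Fin m => matX (tt (m + 1)) L (μ k.castSucc) (y k.castSucc))
        (matX (tt (m + 1)) L (μ (Fin.last m)) (y (Fin.last m))) := fun y =>
    infProd_succ_last fun k => rowFinite_matX _ _ _ _
  have hP' : matProd L (rotate μ) x =
      infMul (matX (tt (m + 1)) L (μ (Fin.last m)) (qq (m + 1) * MvPolynomial.X (Fin.last m)))
        (infProd fun k : Fin m => matX (tt (m + 1)) L (μ k.castSucc)
          (MvPolynomial.X k.castSucc)) := infProd_succ _
  simp only [hP] at h2
  have h3 : (fun s => matProd L (rotate μ) (fun i => x i) s s) = fun s => infMul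
      (matX (tt (m + 1)) L (μ (Fin.last m)) (qq (m + 1) * MvPolynomial.X (Fin.last m)))
        (infProd fun k : Fin m => matX (tt (m + 1)) L (μ k.castSucc)
          (MvPolynomial.X k.castSucc)) s s := funext fun s => congrFun (congrFun hP' s) s
  rw [h3] at h1
  exact IsTwistedSum.cyclic (finite_twistDegree_le L)
    (RowFinite.infProd fun k => rowFinite_matX _ _ _ _) (rowFinite_matX _ _ _ _)
    (fun s k => twist_matX (tt (m + 1)) (qq (m + 1)) hL (hμ _) _ s k) h2 h1

theorem toFrac_X_sub_X_ne_zero {m : ℕ} (i : Fin m) :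
    toFrac (MvPolynomial.X i.castSucc : PolyRing (m + 1)) - toFrac (MvPolynomial.X i.succ) ≠ 0 := by
  rw [sub_ne_zero]
  intro h
  have h' := MvPolynomial.X_injective
    (IsFractionRing.injective (PolyRing (m + 1)) (FractionRing (PolyRing (m + 1))) h)
  exact absurd h' (Fin.castSucc_lt_succ (i := i)).ne

end Main

end MatrixAnsatz

end

open MatrixAnsatz
theorem theoremB2 (m L : ℕ) (hL : 1 ≤ L) (μ : Fin (m + 1) → ℕ) (hμ : ∀ k, μ k ≤ L) :
    HasFormalTrace (ansatzProduct L μ) (traceY L μ) ∧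
    (∀ i : Fin m, μ i.castSucc = μ i.succ →
      heckeT i (traceY L μ) = toFrac (tt (m + 1)) * toFrac (traceY L μ)) ∧
    (∀ i : Fin m, μ i.succ < μ i.castSucc →
      heckeT i (traceY L μ) = toFrac (traceY L (μ ∘ Equiv.swap i.castSucc i.succ))) ∧
    qq (m + 1) ^ μ (Fin.last m) * traceY L μ = shift (traceY L (rotate μ)) := by
  refine ⟨(isTwistedSum_traceY hL μ).hasFormalTrace (finite_twistDegree_le L)
    (ansatzProduct_diag hL μ), fun i hi => ?_, fun i hi => ?_, traceY_rotate hL μ hμ⟩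
  -- For equal labels the exchange relation says $(tx_i-x_{i+1})(Y_\mu-s_iY_\mu)=0$, so the second
  -- term of $T_i$ vanishes.
  · have h := congrArg toFrac (traceY_exchange hL μ hμ i)
    have hne := toFrac_X_sub_X_ne_zero i
    simp only [zfDirect, zfExchange, if_pos hi] at h
    unfold heckeT
    simp only [toFrac, map_mul, map_sub, map_add, map_zero] at h hne ⊢
    rw [div_mul_eq_mul_div, sub_eq_iff_eq_add, eq_comm, add_eq_left, div_eq_zero_iff]
    left
    linear_combination -h
  -- Here $(tx_i-x_{i+1})\,s_iY_\mu=-(1-t)x_{i+1}Y_\mu+(x_i-x_{i+1})Y_{s_i\mu}$, and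
  -- $t(x_i-x_{i+1})-(tx_i-x_{i+1})=(1-t)x_{i+1}$ cancels the $Y_\mu$ terms.
  · have h := congrArg toFrac (traceY_exchange hL μ hμ i)
    have hne := toFrac_X_sub_X_ne_zero i
    simp only [zfDirect, zfExchange, if_neg hi.ne', if_pos hi] at h
    unfold heckeT
    simp only [toFrac, map_mul, map_sub, map_add, map_neg, map_one] at h hne ⊢
    rw [div_mul_eq_mul_div, sub_eq_iff_eq_add, ← sub_eq_iff_eq_add', eq_div_iff hne]
    linear_combination h
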